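/- Let $n$ be a positive integer. For partitions $\mu\subseteq\lambda$, a tableau $T$ of shape $\lambda/\mu$ is a map from the cells $(i,j)$, $\mu_i<j\le\lambda_i$, of the skew Young diagram to the positive integers; we put $T(i,j)=0$ on the cells of $\mu$. It is a Littlewood--Richardson (LR) tableau if its rows weakly increase from left to right, its columns strictly increase from top to bottom, and for all $r\ge1$, $s\ge2$ the number of entries $s$ in the first $r$ rows does not exceed the number of entries $s-1$ in the first $r-1$ rows. Let $\mathcal{LR}(\lambda/\mu,\nu)$ be the set of LR tableaux of shape $\lambda/\mu$ with exactly $\nu_s$ entries $s$ for every $s\ge1$ (empty unless $\mu\subseteq\lambda$), and let $\mathcal{LR}^{(n)}$ be the union of all $\mathcal{LR}(\lambda/\mu,\nu)$ with $\ell(\lambda)\le n$ (a tableau determines its outer shape $\lambda$ and its inner shape $\mu$). For a tableau whose last nonempty row is row $r$, deletion of the last cell of row $r$, which contains $x$ (possibly $x=0$), is defined together with a terminating row number as follows. If $x=r$, the cell is removed and the terminating row number is $0$. If $x=0$, the cell is removed (from both the outer and the inner shape) and the terminating row number is $r$. If $0<x<r$, the cell is removed and $x$ is moved into row $r-1$,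 where it replaces the rightmost entry strictly less than $x$ (entries $0$ included); the replaced entry, if nonzero, is moved into row $r-2$ in the same way, and so on until an entry $0$ is replaced; the terminating row number is the row in which this happens. The full $r$-deletion $\delta_r$ performs this deletion repeatedly until row $r$ has no cells left (it does nothing if row $r$ has no cells). Given $T\in\mathcal{LR}^{(n)}$ of outer shape $\lambda$, put $T^{(n)}=T$ and $T^{(r-1)}=\delta_rT^{(r)}$ for $r=n,n-1,\dots,1$, and let $S=\rho^{(n)}(T)$ be the filling of the Young diagram of $\lambda$ whose row $r$ consists, from left to right, of the terminating row numbers of the successive deletions in the application of $\delta_r$ to $T^{(r)}$; the cells containing $0$ form the inner shape of $S$. **Theorem.** For all partitions $\lambda,\mu,\nu$ with $\ell(\lambda)\le n$, the map $\rho^{(n)}$ restricts to a bijection from $\mathcal{LR}(\lambda/\mu,\nu)$ onto $\mathcal{LR}(\lambda/\nu,\mu)$. Hence $\rho^{(n)}$ is a bijection of $\mathcal{LR}^{(n)}$ onto itself, and it is an involution: $\rho^{(n)}(\rho^{(n)}(T))=T$ for every $T\in\mathcal{LR}^{(n)}$. -/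

import Mathlib

namespace LRTab

/-- The `i`th part `λ_i` (with `i ≥ 1`) of the partition with Young diagram `lam`
(`YoungDiagram.rowLen` numbers the rows from `0`). -/
def part (lam : YoungDiagram) (i : ℕ) : ℕ := lam.rowLen (i - 1)

/-- The length `ℓ(λ)` of a partition: the number of nonzero parts. -/
def length (lam : YoungDiagram) : ℕ := lam.colLen 0

/-- A filling of left-justified rows by natural numbers. Rows and columns are numbered from `1`;
row `i` consists of the cells `(i, 1), …, (i, len i)`, and the cell `(i, j)` contains `entry i j`.
The entry `0` means that the cell is empty. A skew tableau of shape `λ/μ` is encoded as a filling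
of `D(λ)` whose zero entries occupy exactly `D(μ)` (see `IsTableau`); in this way it carries its
outer and its inner shape. -/
@[ext]
structure Filling where
  /-- The length of each row. -/
  len : ℕ → ℕ
  /-- The entry of each cell. -/
  entry : ℕ → ℕ → ℕ

namespace Filling

/-- The filling without cells. -/
def empty : Filling := ⟨fun _ => 0, fun _ _ => 0⟩

/-- Put `x` into the cell `(i, j)`. -/
def setEntry (T : Filling) (i j x : ℕ) : Filling :=
  ⟨T.len, fun a b => if a = i ∧ b = j then x else T.entry a b⟩

/-- Delete the last cell of row `r`. -/
def removeLast (T : Filling) (r : ℕ) : Filling :=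
  ⟨fun a => if a = r then T.len r - 1 else T.len a,
    fun a b => if a = r ∧ b = T.len r then 0 else T.entry a b⟩

/-- Install the row `w 1, …, w m` as row `r`. -/
def setRow (T : Filling) (r m : ℕ) (w : ℕ → ℕ) : Filling :=
  ⟨fun a => if a = r then m else T.len a,
    fun a b => if a = r then (if 1 ≤ b ∧ b ≤ m then w b else 0) else T.entry a b⟩

/-- The number of entries `s` in the first `r` rows. -/
def count (T : Filling) (s r : ℕ) : ℕ :=
  ∑ i ∈ Finset.Icc 1 r, ((Finset.Icc 1 (T.len i)).filter (fun j => T.entry i j = s)).card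

/-- The column of the rightmost entry strictly less than `x` in row `k`
(`0` if there is no such entry). -/
def rightmostLess (T : Filling) (k x : ℕ) : ℕ :=
  Nat.findGreatest (fun j => 1 ≤ j ∧ T.entry k j < x) (T.len k)

end Filling

/-- `T` is a tableau of shape `λ/μ`, where `μ ⊆ λ`: a map from the cells `(i, j)` of `D(λ/μ)`,
that is `1 ≤ i` and `μ_i < j ≤ λ_i`, to the positive integers. The entry is `0` elsewhere, and the
row lengths of the filling are those of `λ`. -/
structure IsTableau (lam mu : YoungDiagram) (T : Filling) : Prop where
  inner_le : mu ≤ lam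
  len_zero : T.len 0 = 0
  len_eq : ∀ i, 1 ≤ i → T.len i = part lam i
  entry_pos_iff : ∀ i j, 0 < T.entry i j ↔ 1 ≤ i ∧ part mu i < j ∧ j ≤ part lam i

/-- Entries weakly increase along rows and strictly increase down columns of `D(λ/μ)`. -/
structure IsSemistandard (lam mu : YoungDiagram) (T : Filling) : Prop where
  row_weak : ∀ i j, 1 ≤ i → part mu i < j → j + 1 ≤ part lam i →
    T.entry i j ≤ T.entry i (j + 1)
  col_strict : ∀ i j, 1 ≤ i → part mu i < j → j ≤ part lam i →
    part mu (i + 1) < j → j ≤ part lam (i + 1) → T.entry i j < T.entry (i + 1) j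

/-- The lattice permutation property: the number of entries `s` in the first `r` rows does not
exceed the number of entries `s - 1` in the first `r - 1` rows. -/
def IsLattice (T : Filling) : Prop :=
  ∀ r s, 1 ≤ r → 2 ≤ s → T.count s r ≤ T.count (s - 1) (r - 1)

/-- The set of Littlewood--Richardson tableaux of shape `λ/μ` and weight `ν`. -/
def LR (lam mu nu : YoungDiagram) : Set Filling :=
  {T | IsTableau lam mu T ∧ IsSemistandard lam mu T ∧ IsLattice T ∧
    ∀ s, 1 ≤ s → T.count s (length lam) = part nu s}

/-- The set of Littlewood--Richardson tableaux (of any shape and weight) with at most `n` rows. -/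
def LRn (n : ℕ) : Set Filling :=
  {T | ∃ lam mu nu : YoungDiagram, length lam ≤ n ∧ T ∈ LR lam mu nu}

/-- Bump the nonzero letter `x` into row `k`: it replaces the rightmost entry strictly less than
`x`. If the replaced entry is `0`, the process ends with terminating row number `k`; otherwise the
replaced entry is bumped into row `k - 1`, and so on. The result is the new filling with the
terminating row number. (For Littlewood--Richardson tableaux a smaller entry always exists, and the
process ends in a row `k ≥ 1`; the value for `k = 0` is irrelevant.) -/
def bumpUp : ℕ → ℕ → Filling → Filling × ℕ
  | 0, _, T => (T, 0)
  | k + 1, x, T =>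
    let j := T.rightmostLess (k + 1) x
    let y := T.entry (k + 1) j
    let T' := T.setEntry (k + 1) j x
    if y = 0 then (T', k + 1) else bumpUp k y T'

/-- The deletion operator on the last cell of row `r`, with its terminating row number:
(i) if the cell contains `r`, it is just deleted, with terminating row number `0`;
(iii) if it contains `0`, it is just deleted, with terminating row number `r`;
(ii) otherwise it is deleted and its entry is bumped into row `r - 1`. -/
def deleteLast (r : ℕ) (T : Filling) : Filling × ℕ :=
  let x := T.entry r (T.len r)
  if x = r then (T.removeLast r, 0)
  else if x = 0 then (T.removeLast r, r)
  else bumpUp (r - 1) x (T.removeLast r)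

/-- The result of the first `i` of the successive deletions of the last cell of row `r`. -/
def deleteIter (r i : ℕ) (T : Filling) : Filling :=
  (fun T' => (deleteLast r T').1)^[i] T

/-- The full `r`-deletion: the last cell of row `r` is deleted as often as this row has cells. -/
def fullDelete (r : ℕ) (T : Filling) : Filling := deleteIter r (T.len r) T

/-- The terminating row number of the `i`th deletion (`i ≥ 1`) in the full `r`-deletion of `T`. -/
def termRow (r : ℕ) (T : Filling) (i : ℕ) : ℕ := (deleteLast r (deleteIter r (i - 1) T)).2

/-- One step `(T, S) ↦ (T', S')`: the full `r`-deletion is applied to `T`, and the terminating row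
numbers, in the order in which they occur, become the new top row of `S`, which is row `r`. -/
def step (r : ℕ) (p : Filling × Filling) : Filling × Filling :=
  (fullDelete r p.1, p.2.setRow r (p.1.len r) (termRow r p.1))

/-- The steps for rows `n, n - 1, …, 1`, in this order. -/
def allSteps : ℕ → Filling × Filling → Filling × Filling
  | 0, p => p
  | r + 1, p => allSteps r (step (r + 1) p)

/-- The map `ρ^(n)`, sending a tableau with at most `n` rows to its partner tableau. -/
def rho (n : ℕ) (T : Filling) : Filling := (allSteps n (T, Filling.empty)).2

end LRTab

/-! A tableau is replaced by the numbers `G i y` of letters `> y` in its first `i` rows. Row order,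
column strictness and the lattice property become the linear inequalities `Hive`, and both fillings
and hives determine each other through `Rep`.

The full deletion of row `n + 1` turns `G` into the unique `G'` solving the octahedron recurrence
`Oct` with boundary values `G' n y = G (n + 1) y - G (n + 1) n` and `G' i y = 0` for `y ≥ i`
(`fullDelete_spec`). This is proved one cell at a time: a partial deletion already satisfies the
recurrence, with another boundary row, and one more bump preserves it (`Bumping.oct`).

Let `F r` be the hive of the tableau left when only rows `1, …, r` remain. A deletion with
terminating row `k > 0` takes one cell of the inner shape out of row `k`. So the number of entries
`> k` in the first `r` rows of the partner is the number of empty cells in rows `k + 1, …, r` of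
that tableau, which is `partner r k`. Its hive inequalities (`Family.partner_hive`) come from the
interlacing of successive inner shapes and from the octahedron recurrence. In particular inner shape
and weight change places.

For the involution, the deletions of the first `m + 1` rows of a tableau are compared with those of
its first `m` rows. The two families are again linked by octahedron relations, by four-dimensional
consistency of the recurrence (`Family.consistency`). At `y = 0` this says that dropping the last
row of the tableau amounts to a full deletion on the partner (`partner_del`). Hence the deletion
family of the partner consists of the partners of the truncations of `T`, and its inner shapes
return the hive of `T` (`partner_partner`). -/

namespace LRTab

/-! ### Hives and the octahedron recurrence -/

/-- The inequalities satisfied by the numbers `G i y` of letters `> y` in the first `i` rows of a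
Littlewood--Richardson tableau with `n` rows of lengths `len`. -/
structure Hive (n : ℕ) (len : ℕ → ℕ) (G : ℕ → ℕ → ℤ) : Prop where
  zero : ∀ y, G 0 y = 0
  top : ∀ i y, i ≤ n → i ≤ y → G i y = 0
  row : ∀ i y, i < n → G (i + 1) (y + 1) + G i y ≤ G (i + 1) y + G i (y + 1)
  inner : ∀ i, i < n → G (i + 1) 0 ≤ len (i + 1) + G i 0
  col : ∀ i y, i + 1 < n → len (i + 2) + G (i + 1) y + G (i + 1) (y + 1) ≤
    len (i + 1) + G (i + 2) (y + 1) + G i y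
  col_zero : ∀ i, i + 1 < n → len (i + 2) + 2 * G (i + 1) 0 ≤ len (i + 1) + G (i + 2) 0 + G i 0
  lat : ∀ i y, i < n → G (i + 1) (y + 1) + G i (y + 1) ≤ G i y + G (i + 1) (y + 2)

/-- The octahedron relation between a hive `G` and the result `G'` of a deletion into the first
`n` rows. -/
def Oct (n : ℕ) (G G' : ℕ → ℕ → ℤ) : Prop :=
  ∀ i y, i < n → G' i y + G (i + 1) (y + 1) =
    min (G' (i + 1) (y + 1) + G i y) (G' i (y + 1) + G (i + 1) y)

/-- The relation between a hive `G` and the result `G'` of the deletion of a final part of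
row `n + 1`. -/
structure Flow (n : ℕ) (G G' : ℕ → ℕ → ℤ) : Prop where
  oct : Oct n G G'
  top : ∀ i y, i ≤ n → i ≤ y → G' i y = 0
  last_anti : ∀ y, G' n (y + 1) + G n y ≤ G' n y + G n (y + 1)
  last_le : ∀ y, G' n y + G (n + 1) (y + 1) ≤ G' n (y + 1) + G (n + 1) y

/-- The relation between a hive `G` with `n + 1` rows and its full deletion `G'`. -/
structure Del (n : ℕ) (G G' : ℕ → ℕ → ℤ) : Prop where
  oct : Oct n G G'
  top : ∀ i y, i ≤ n → i ≤ y → G' i y = 0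
  last : ∀ y, y ≤ n → G' n y = G (n + 1) y - G (n + 1) n

theorem down_induction {n : ℕ} {p : ℕ → Prop} (base : ∀ y, n ≤ y → p y)
    (step : ∀ y, y < n → p (y + 1) → p y) (y : ℕ) : p y := by
  by_cases h : n ≤ y
  · exact base y h
  · exact Nat.decreasingInduction' (P := p) (n := n) (fun k hk _ ih => step k hk ih) (by omega)
      (base n le_rfl)

namespace Hive

variable {n : ℕ} {len : ℕ → ℕ} {G : ℕ → ℕ → ℤ}

theorem congr_len {len' : ℕ → ℕ} (h : Hive n len G) (hl : ∀ i, i < n → len' (i + 1) = len (i + 1)) :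
    Hive n len' G where
  zero := h.zero
  top := h.top
  row := h.row
  inner i hi := by rw [hl i hi]; exact h.inner i hi
  col i y hi := by rw [hl i (by omega), hl (i + 1) hi]; exact h.col i y hi
  col_zero i hi := by rw [hl i (by omega), hl (i + 1) hi]; exact h.col_zero i hi
  lat := h.lat

theorem anti (h : Hive n len G) (i : ℕ) (hi : i ≤ n) (y : ℕ) : G i (y + 1) ≤ G i y := by
  induction i with
  | zero => simp [h.zero]
  | succ i ih =>
    have := h.row i y (by omega)
    have := ih (by omega)
    omega

theorem nonneg (h : Hive n len G) (i : ℕ) (hi : i ≤ n) (y : ℕ) : 0 ≤ G i y := by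
  refine down_induction (n := i) (p := fun y => 0 ≤ G i y) ?_ ?_ y
  · intro y hy
    exact (h.top i y hi hy).ge
  · intro y _ ih
    exact ih.trans (h.anti i hi y)

theorem len_anti (h : Hive n len G) (i : ℕ) (hi : i + 1 < n) : len (i + 2) ≤ len (i + 1) := by
  have := h.col i (i + 2) hi
  rw [h.top (i + 1) _ (by omega) (by omega), h.top (i + 1) _ (by omega) (by omega),
    h.top (i + 2) _ (by omega) (by omega), h.top i _ (by omega) (by omega)] at this
  omega

end Hive

/-! ### Consequences of the recurrence: a deletion yields a hive again -/

namespace Flow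

variable {n : ℕ} {len : ℕ → ℕ} {G G' : ℕ → ℕ → ℤ}

theorem le_left (h : Flow n G G') (i y : ℕ) (hi : i < n) :
    G' i y + G (i + 1) (y + 1) ≤ G' (i + 1) (y + 1) + G i y := by
  have := h.oct i y hi
  omega

theorem le_right (h : Flow n G G') (i y : ℕ) (hi : i ≤ n) :
    G' i y + G (i + 1) (y + 1) ≤ G' i (y + 1) + G (i + 1) y := by
  rcases hi.lt_or_eq with hi | rfl
  · have := h.oct i y hi
    omega
  · exact h.last_le y

/-- The difference `G' i y - G i y` should count the letters `> y` that have entered the first `i`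
rows, so it decreases in `y`. This is assumed in row `n`; the recurrence carries it upwards,
whichever term attains the minimum. -/
theorem anti (h : Flow n G G') (hG : Hive (n + 1) len G) (i : ℕ) (hi : i ≤ n) (y : ℕ) :
    G' i (y + 1) + G i y ≤ G' i y + G i (y + 1) := by
  refine down_induction (n := n)
    (p := fun i => i ≤ n → ∀ y, G' i (y + 1) + G i y ≤ G' i y + G i (y + 1)) ?_ ?_ i hi y
  · intro i hn hi y
    obtain rfl : i = n := by omega
    exact h.last_anti y
  · intro i hi ih _ y
    have h1 := h.le_left i (y + 1) hi
    have h2 := ih (by omega) (y + 1)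
    have h3 := h.oct i y hi
    have h4 := hG.row i y (by omega)
    omega

theorem mono_row (h : Flow n G G') (hG : Hive (n + 1) len G) (i : ℕ) (hi : i < n) (y : ℕ) :
    G' i y + G (i + 1) y ≤ G' (i + 1) y + G i y := by
  have := h.le_left i y hi
  have := h.anti hG (i + 1) (by omega) y
  omega

theorem le (h : Flow n G G') (hG : Hive (n + 1) len G) (i : ℕ) (hi : i ≤ n) (y : ℕ) :
    G i y ≤ G' i y := by
  refine down_induction (n := i) (p := fun y => G i y ≤ G' i y) ?_ ?_ y
  · intro y hy
    rw [h.top i y hi hy, hG.top i y (by omega) hy]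
  · intro y _ ih
    have := h.anti hG i hi y
    omega

theorem le_last (h : Flow n G G') (hG : Hive (n + 1) len G) (i : ℕ) (hi : i ≤ n) (y : ℕ) :
    G' i y + G n y ≤ G' n y + G i y := by
  refine down_induction (n := n)
    (p := fun i => i ≤ n → G' i y + G n y ≤ G' n y + G i y) ?_ ?_ i hi
  · intro i hn hi
    obtain rfl : i = n := by omega
    exact le_rfl
  · intro i hi ih _
    have := h.mono_row hG i hi y
    have := ih (by omega)
    omega

/-- Row `i + 2` before the deletion has at most as many entries `≤ y` as row `i + 1` after it; for
`y = 0` the inner shapes interlace. Where the minimum in the recurrence is its first term, old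
column strictness suffices; where it is the second, the claim for `y + 1` does. -/
theorem interlace (h : Flow n G G') (hG : Hive (n + 1) len G) (i : ℕ) (hi : i < n) (y : ℕ) :
    len (i + 2) + G' (i + 1) y + G (i + 1) y ≤ len (i + 1) + G (i + 2) y + G' i y := by
  refine down_induction (n := n + 1) (p := fun y =>
    len (i + 2) + G' (i + 1) y + G (i + 1) y ≤ len (i + 1) + G (i + 2) y + G' i y) ?_ ?_ y
  · intro y hy
    have := hG.len_anti i (by omega)
    rw [h.top _ _ (by omega) (by omega), h.top _ _ (by omega) (by omega),
      hG.top _ _ (by omega) (by omega), hG.top _ _ (by omega) (by omega)]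
    omega
  · intro y _ ih
    have h1 := h.oct i y hi
    have h2 := h.le_right (i + 1) y (by omega)
    have h3 := hG.col i y (by omega)
    have h4 : G (i + 1 + 1) = G (i + 2) := rfl
    rw [h4] at h2
    omega

theorem hive (h : Flow n G G') (hG : Hive (n + 1) len G) (h0 : ∀ y, G' 0 y = 0) :
    Hive n len G' where
  zero := h0
  top := h.top
  row i y hi := by
    have := h.le_right i y (by omega)
    have := h.anti hG (i + 1) (by omega) y
    omega
  inner i hi := by
    have := h.interlace hG i hi 0
    have := hG.inner (i + 1) (by omega)
    have h4 : G (i + 1 + 1) = G (i + 2) := rfl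
    have h5 : len (i + 1 + 1) = len (i + 2) := rfl
    rw [h4, h5] at this
    omega
  col i y hi := by
    have h1 := h.oct i y (by omega)
    have h2 := h.le_left (i + 1) y (by omega)
    have h3 := hG.col i y (by omega)
    have h4 := h.interlace hG i (by omega) (y + 1)
    have e4 : G (i + 1 + 1) = G (i + 2) := rfl
    have e5 : G' (i + 1 + 1) = G' (i + 2) := rfl
    rw [e4, e5] at h2
    omega
  col_zero i hi := by
    have h1 := h.interlace hG i (by omega) 0
    have h2 := h.mono_row hG (i + 1) (by omega) 0
    have e4 : G (i + 1 + 1) = G (i + 2) := rfl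
    have e5 : G' (i + 1 + 1) = G' (i + 2) := rfl
    rw [e4, e5] at h2
    omega
  lat i y hi := by
    have h1 := h.oct i y hi
    have h2 := h.le_left i (y + 1) hi
    have h3 := hG.lat i y (by omega)
    have h4 := hG.lat (i + 1) y (by omega)
    have h5 := h.le_right (i + 1) (y + 1) (by omega)
    have e4 : G (i + 1 + 1) = G (i + 2) := rfl
    rw [e4] at h4 h5
    rw [show y + 1 + 1 = y + 2 from rfl] at *
    omega

end Flow

namespace Del

variable {n : ℕ} {len : ℕ → ℕ} {G G' : ℕ → ℕ → ℤ}

theorem flow (h : Del n G G') (hG : Hive (n + 1) len G) : Flow n G G' where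
  oct := h.oct
  top := h.top
  last_anti y := by
    rcases lt_or_ge y n with hy | hy
    · have := h.last y hy.le
      have := h.last (y + 1) hy
      have := hG.row n y (by omega)
      omega
    · have := h.top n y le_rfl hy
      have := h.top n (y + 1) le_rfl (by omega)
      have := hG.anti n (by omega) y
      have := hG.top n y (by omega) hy
      have := hG.top n (y + 1) (by omega) (by omega)
      omega
  last_le y := by
    rcases lt_or_ge y n with hy | hy
    · have := h.last y hy.le
      have := h.last (y + 1) hy
      omega
    · have := h.top n y le_rfl hy
      have := h.top n (y + 1) le_rfl (by omega)
      have := hG.anti (n + 1) (by omega) y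
      omega

/-- The recurrence gives `G' i y` from `G' (i + 1) (y + 1)` and `G' i (y + 1)`, so the last row and
the vanishing for `y ≥ i` fix everything by descending induction. -/
theorem unique {H H' : ℕ → ℕ → ℤ} (h : Del n G G') (h' : Del n H H')
    (e : ∀ i y, i ≤ n + 1 → G i y = H i y) (i y : ℕ) (hi : i ≤ n) : G' i y = H' i y := by
  refine down_induction (n := n) (p := fun i => i ≤ n → ∀ y, G' i y = H' i y) ?_ ?_ i hi y
  · intro i hn hi y
    obtain rfl : i = n := by omega
    rcases le_or_gt y i with hy | hy
    · rw [h.last y hy, h'.last y hy, e _ _ le_rfl, e _ _ le_rfl]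
    · rw [h.top _ _ le_rfl hy.le, h'.top _ _ le_rfl hy.le]
  · intro i hi ih _ y
    refine down_induction (n := n) (p := fun y => G' i y = H' i y) ?_ ?_ y
    · intro y hy
      rw [h.top _ _ hi.le (by omega), h'.top _ _ hi.le (by omega)]
    · intro y _ ihy
      have h1 := h.oct i y hi
      have h2 := h'.oct i y hi
      rw [ih (by omega), e _ _ (by omega), e _ _ (by omega), e _ _ (by omega), ihy] at h1
      omega

end Del

/-! ### Successive deletions and the partner hive -/

/-- The hives of the successive full deletions of a tableau with `n` rows. -/
structure Family (n : ℕ) (len : ℕ → ℕ) (F : ℕ → ℕ → ℕ → ℤ) : Prop where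
  hive : ∀ r, r ≤ n → Hive r len (F r)
  del : ∀ r, r < n → Del r (F (r + 1)) (F r)

/-- The sum of the first `r` row lengths. -/
def lenSum (len : ℕ → ℕ) (r : ℕ) : ℤ := ∑ i ∈ Finset.range r, (len (i + 1) : ℤ)

@[simp] theorem lenSum_zero (len : ℕ → ℕ) : lenSum len 0 = 0 := by simp [lenSum]

theorem lenSum_succ (len : ℕ → ℕ) (r : ℕ) : lenSum len (r + 1) = lenSum len r + len (r + 1) := by
  simp [lenSum, Finset.sum_range_succ]

/-- The hive of the partner tableau, read off from the inner shapes of the successive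
deletions. -/
def partner (len : ℕ → ℕ) (F : ℕ → ℕ → ℕ → ℤ) (r k : ℕ) : ℤ :=
  if k ≤ r then lenSum len r - lenSum len k - F r r 0 + F r k 0 else 0

theorem partner_of_le (len : ℕ → ℕ) (F : ℕ → ℕ → ℕ → ℤ) {r k : ℕ} (h : k ≤ r) :
    partner len F r k = lenSum len r - lenSum len k - F r r 0 + F r k 0 := if_pos h

theorem partner_of_ge (len : ℕ → ℕ) (F : ℕ → ℕ → ℕ → ℤ) {r k : ℕ} (h : r ≤ k) :
    partner len F r k = 0 := by
  rcases h.lt_or_eq with h | rfl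
  · exact if_neg (by omega)
  · rw [partner_of_le _ _ le_rfl]; ring

namespace Family

variable {n : ℕ} {len : ℕ → ℕ} {F : ℕ → ℕ → ℕ → ℤ}

theorem flow (h : Family n len F) (r : ℕ) (hr : r < n) : Flow r (F (r + 1)) (F r) :=
  (h.del r hr).flow (h.hive (r + 1) hr)

/-- Only letters equal to the row number leave the tableau, so at level `r` the weight is the
original one cut off after its `r`th part. -/
theorem last_eq (h : Family n len F) (r : ℕ) (hr : r ≤ n) (y : ℕ) (hy : y ≤ r) :
    F r r y = F n n y - F n n r := by
  refine down_induction (n := n)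
    (p := fun r => r ≤ n → ∀ y, y ≤ r → F r r y = F n n y - F n n r) ?_ ?_ r hr y hy
  · intro r hn hr y _
    obtain rfl : r = n := by omega
    rw [(h.hive r le_rfl).top r r le_rfl le_rfl, sub_zero]
  · intro r hr ih _ y hy
    rw [(h.del r hr).last y hy, ih (by omega) y (by omega), ih (by omega) r (by omega)]
    ring

/-- The left side is the number of letters `r + 2` at level `r + 2`. The first bound is the lattice
property in the last row; the second follows because the next deletion keeps every letter `r + 1`.
-/
theorem last_lt (h : Family n len F) (r : ℕ) (hr : r + 2 ≤ n) :
    F (r + 2) (r + 2) (r + 1) ≤ F (r + 2) (r + 1) r ∧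
      F (r + 2) (r + 2) (r + 1) ≤ F (r + 1) (r + 1) r := by
  have h2 := h.hive (r + 2) hr
  have h3 := h2.lat (r + 1) r (by omega)
  have h4 := h2.row (r + 1) r (by omega)
  have h5 := (h.del (r + 1) (by omega)).last r (by omega)
  have e1 : F (r + 1 + 1) = F (r + 2) := rfl
  have e2 : F (r + 2) (r + 1 + 1) = F (r + 2) (r + 2) := rfl
  rw [e1] at h5
  rw [e2] at h3 h4 h5
  have h6 := h2.top (r + 1) (r + 1) (by omega) le_rfl
  have h7 := h2.top (r + 2) (r + 2) (by omega) le_rfl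
  omega

/-- At `y = 0` this is column strictness of the partner. The statement for all `y` is what makes the
double descending induction possible, since the recurrence relates `y` to `y + 1`. -/
theorem partner_col (h : Family n len F) (r : ℕ) (hr : r + 2 ≤ n) (k : ℕ) (hk : k ≤ r)
    (y : ℕ) (hy : y ≤ r) :
    F (r + 1) k y + F (r + 1) (k + 1) y + F (r + 2) (r + 2) (r + 1) ≤
      F (r + 2) (k + 1) y + F r k y + F (r + 1) (r + 1) r := by
  have f1 : Flow (r + 1) (F (r + 2)) (F (r + 1)) := h.flow (r + 1) (by omega)
  have f0 := h.flow r (by omega)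
  have d0 := h.del r (by omega)
  have hc := h.last_lt r hr
  refine down_induction (n := r) (p := fun k => k ≤ r → ∀ y, y ≤ r →
    F (r + 1) k y + F (r + 1) (k + 1) y + F (r + 2) (r + 2) (r + 1) ≤
      F (r + 2) (k + 1) y + F r k y + F (r + 1) (r + 1) r) ?_ ?_ k hk y hy
  · intro k hk hk' y hy
    obtain rfl : k = r := by omega
    rw [d0.last y hy]
    refine down_induction (n := k) (p := fun y => y ≤ k →
      F (k + 1) k y + F (k + 1) (k + 1) y + F (k + 2) (k + 2) (k + 1) ≤
      F (k + 2) (k + 1) y + (F (k + 1) (k + 1) y - F (k + 1) (k + 1) k) +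
        F (k + 1) (k + 1) k) ?_ ?_ y hy
    · intro y h1 h2
      obtain rfl : y = k := by omega
      have := f1.top y y (by omega) le_rfl
      omega
    · intro y hy ih _
      have := ih hy
      have := f1.le_right k y (by omega)
      omega
  · intro k hk ih _ y hy
    refine down_induction (n := r) (p := fun y => y ≤ r →
      F (r + 1) k y + F (r + 1) (k + 1) y + F (r + 2) (r + 2) (r + 1) ≤
      F (r + 2) (k + 1) y + F r k y + F (r + 1) (r + 1) r) ?_ ?_ y hy
    · intro y h1 h2
      rw [f1.top _ _ (by omega) (by omega), f1.top _ _ (by omega) (by omega),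
        f0.top _ _ (by omega) (by omega), (h.hive (r + 2) hr).top (k + 1) y (by omega) (by omega)]
      omega
    · intro y hy ihy _
      have h1 := ihy hy
      have h2 := ih hk (y + 1) hy
      have h3 := f0.oct k y hk
      have h4 := f1.le_left (k + 1) y (by omega)
      have h5 := f1.le_right k y (by omega)
      omega

/-- The conditions change roles: rows of the partner increase because inner shapes shrink
(`mono_row`), the lattice property is the interlacing of inner shapes (`interlace`), and the inner
shape condition `col_zero` is the monotonicity of the weight (`last_lt`). -/
theorem partner_hive (h : Family n len F) : Hive n len (partner len F) where
  zero y := by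
    exact partner_of_ge _ _ (Nat.zero_le y)
  top i y _ hy := partner_of_ge _ _ hy
  row r k hr := by
    rcases lt_trichotomy k r with hk | rfl | hk
    · rw [partner_of_le _ _ (by omega), partner_of_le _ _ (by omega),
        partner_of_le _ _ (by omega), partner_of_le _ _ (by omega)]
      have := (h.flow r hr).mono_row (h.hive (r + 1) hr) k hk 0
      omega
    · rw [partner_of_ge _ _ le_rfl, partner_of_ge _ _ le_rfl, partner_of_ge _ _ (Nat.le_succ k),
        partner_of_le _ _ (by omega), lenSum_succ]
      have := (h.hive (k + 1) hr).inner k (by omega)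
      omega
    · rw [partner_of_ge _ _ (by omega), partner_of_ge _ _ (by omega),
        partner_of_ge _ _ (by omega), partner_of_ge _ _ (by omega)]
  inner r hr := by
    rw [partner_of_le _ _ (by omega), partner_of_le _ _ (by omega), lenSum_succ,
      (h.hive r hr.le).top 0 0 (by omega) le_rfl, (h.hive (r + 1) hr).top 0 0 (by omega) le_rfl,
      (h.del r hr).last 0 (by omega)]
    have := (h.hive (r + 1) hr).nonneg (r + 1) (by omega) r
    omega
  col r k hr := by
    have hc := h.last_lt r (by omega)
    rcases lt_trichotomy k (r + 1) with hk | rfl | hk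
    · rw [partner_of_le _ _ (by omega), partner_of_le _ _ (by omega),
        partner_of_le _ _ (by omega), partner_of_le _ _ (by omega), lenSum_succ len (r + 1),
        lenSum_succ len r, lenSum_succ len k, (h.del r (by omega)).last 0 (by omega)]
      have h1 := h.partner_col r hr k (by omega) 0 (by omega)
      have h2 := (h.del (r + 1) hr).last 0 (by omega)
      have e1 : F (r + 1 + 1) = F (r + 2) := rfl
      have e2 : F (r + 2) (r + 1 + 1) = F (r + 2) (r + 2) := rfl
      have e3 : len (r + 1 + 1) = len (r + 2) := rfl
      rw [e1, e2] at h2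
      rw [e3]
      omega
    · rw [partner_of_ge _ _ (by omega), partner_of_ge _ _ (by omega),
        partner_of_ge _ _ (by omega), partner_of_ge _ _ (by omega)]
      have := (h.hive n le_rfl).len_anti r hr
      omega
    · rw [partner_of_ge _ _ (by omega), partner_of_ge _ _ (by omega),
        partner_of_ge _ _ (by omega), partner_of_ge _ _ (by omega)]
      have := (h.hive n le_rfl).len_anti r hr
      omega
  col_zero r hr := by
    have hc := h.last_lt r (by omega)
    rw [partner_of_le _ _ (by omega), partner_of_le _ _ (by omega),
      partner_of_le _ _ (by omega), lenSum_succ len (r + 1),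
      lenSum_succ len r, (h.hive r (by omega)).zero, (h.hive (r + 1) (by omega)).zero,
      (h.hive (r + 2) (by omega)).zero, (h.del r (by omega)).last 0 (by omega)]
    have h2 := (h.del (r + 1) hr).last 0 (by omega)
    have e1 : F (r + 1 + 1) = F (r + 2) := rfl
    have e2 : F (r + 2) (r + 1 + 1) = F (r + 2) (r + 2) := rfl
    have e3 : len (r + 1 + 1) = len (r + 2) := rfl
    rw [e1, e2] at h2
    rw [e3]
    omega
  lat r k hr := by
    rcases lt_or_ge k r with hk | hk
    · rw [partner_of_le _ _ (by omega), partner_of_le _ _ (by omega),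
        partner_of_le _ _ (by omega), partner_of_le _ _ (by omega), lenSum_succ len (k + 1),
        lenSum_succ len k]
      have := (h.flow r hr).interlace (h.hive (r + 1) hr) k hk 0
      have e3 : len (k + 1 + 1) = len (k + 2) := rfl
      rw [e3]
      omega
    · rw [partner_of_ge _ _ (by omega), partner_of_ge _ _ (by omega),
        partner_of_ge _ _ (by omega), partner_of_ge _ _ (by omega)]

end Family


/-! ### Dropping the last row, and the partner of the partner -/

namespace Family

variable {m : ℕ} {len : ℕ → ℕ} {P Q : ℕ → ℕ → ℕ → ℤ}

theorem last_row_mono (hP : Family (m + 1) len P) (hQ : Family m len Q)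
    (e : ∀ i y, i ≤ m → P (m + 1) i y = Q m i y) (r : ℕ) (hr : r < m) :
    Q (r + 1) (r + 1) r ≤ P (r + 1) (r + 1) r := by
  rw [hP.last_eq (r + 1) (by omega) r (by omega), hQ.last_eq (r + 1) (by omega) r (by omega),
    ← e _ _ le_rfl, ← e _ _ le_rfl]
  have := (hP.hive (m + 1) le_rfl).row m r (by omega)
  omega

/-- Four-dimensional consistency of the octahedron recurrence, for the families belonging to the
first `m + 1` and to the first `m` rows of a tableau. -/
theorem consistency (hP : Family (m + 1) len P) (hQ : Family m len Q)
    (e : ∀ i y, i ≤ m → P (m + 1) i y = Q m i y) (r : ℕ) (hr : r < m)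
    (h : Oct (r + 1) (Q (r + 1)) (P (r + 1))) (i : ℕ) (hi : i ≤ r) (y : ℕ) (hy : y ≤ r) :
    (i < r → Q r i y + P (r + 1) (i + 1) y =
      min (Q (r + 1) (i + 1) y + P r i y + (P (r + 1) (r + 1) r - Q (r + 1) (r + 1) r))
        (Q r (i + 1) y + P (r + 1) i y)) ∧
    (y < r → P (r + 1) i y + Q r i (y + 1) =
      min (Q r i y + P (r + 1) i (y + 1))
        (P r i (y + 1) + Q (r + 1) i y + (P (r + 1) (r + 1) r - Q (r + 1) (r + 1) r))) ∧
    (i < r → y < r → P r i y + Q r (i + 1) (y + 1) =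
      min (P r (i + 1) (y + 1) + Q r i y) (P r i (y + 1) + Q r (i + 1) y)) := by
  have he := last_row_mono hP hQ e r hr
  -- By `last_eq`, `c` is the number of letters `r + 1` in row `m + 1`. It compensates for the
  -- different normalizations of `P` and `Q` when passing from level `r + 1` to level `r`.
  generalize hc : P (r + 1) (r + 1) r - Q (r + 1) (r + 1) r = c at *
  have dP := hP.del r (by omega)
  have dQ := hQ.del r hr
  have hivP := hP.hive (r + 1) (by omega)
  have hivQ := hQ.hive (r + 1) (by omega)
  refine down_induction (n := r) (p := fun i => i ≤ r → ∀ y, y ≤ r →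
    (i < r → Q r i y + P (r + 1) (i + 1) y =
      min (Q (r + 1) (i + 1) y + P r i y + c) (Q r (i + 1) y + P (r + 1) i y)) ∧
    (y < r → P (r + 1) i y + Q r i (y + 1) =
      min (Q r i y + P (r + 1) i (y + 1)) (P r i (y + 1) + Q (r + 1) i y + c)) ∧
    (i < r → y < r → P r i y + Q r (i + 1) (y + 1) =
      min (P r (i + 1) (y + 1) + Q r i y) (P r i (y + 1) + Q r (i + 1) y))) ?_ ?_ i hi y hy
  -- For `i = r` only the second relation has content; inserting the boundary rows turns it into the
  -- octahedron relation `h` one level up.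
  · intro i h1 h2 y hy
    obtain rfl : i = r := by omega
    refine ⟨by omega, fun hy => ?_, by omega⟩
    have := h i y (by omega)
    rw [dP.last _ (by omega), dQ.last _ (by omega), dQ.last _ (by omega)]
    omega
  · intro i hi ih _ y hy
    refine down_induction (n := r) (p := fun y => y ≤ r →
      (i < r → Q r i y + P (r + 1) (i + 1) y =
        min (Q (r + 1) (i + 1) y + P r i y + c) (Q r (i + 1) y + P (r + 1) i y)) ∧
      (y < r → P (r + 1) i y + Q r i (y + 1) =
        min (Q r i y + P (r + 1) i (y + 1)) (P r i (y + 1) + Q (r + 1) i y + c)) ∧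
      (i < r → y < r → P r i y + Q r (i + 1) (y + 1) =
        min (P r (i + 1) (y + 1) + Q r i y) (P r i (y + 1) + Q r (i + 1) y))) ?_ ?_ y hy
    · intro y h1 h2
      refine ⟨fun _ => ?_, by omega, by omega⟩
      rw [dP.top i y (by omega) (by omega), dQ.top i y (by omega) (by omega),
        dQ.top (i + 1) y (by omega) (by omega), hivP.top (i + 1) y (by omega) (by omega),
        hivP.top i y (by omega) (by omega), hivQ.top (i + 1) y (by omega) (by omega)]
      omega
    · intro y hy ihy _
      -- One cell of four-dimensional consistency: three octahedron relations at `(i, y)`, the first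
      -- relation at `(i, y + 1)` and the second at `(i + 1, y)` imply all three relations at `(i,
      -- y)` by min-plus arithmetic.
      have k1 := dP.oct i y hi
      have k2 := dQ.oct i y hi
      have k3 := h i y (by omega)
      have k4 := (ihy hy).1 hi
      have k5 := (ih hi y hy.le).2.1 hy
      clear ih ihy
      refine ⟨fun _ => ?_, fun _ => ?_, fun _ _ => ?_⟩
      all_goals omega

/-- At level `m` this is the deletion relation itself, since `Q m` agrees with `P (m + 1)` in the
first `m` rows. The third relation of `consistency` passes it down level by level. -/
theorem oct_between (hP : Family (m + 1) len P) (hQ : Family m len Q)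
    (e : ∀ i y, i ≤ m → P (m + 1) i y = Q m i y) (r : ℕ) (hr : r ≤ m) :
    Oct r (Q r) (P r) := by
  refine down_induction (n := m) (p := fun r => r ≤ m → Oct r (Q r) (P r)) ?_ ?_ r hr
  · intro r h1 h2 i y hi
    obtain rfl : r = m := by omega
    have := (hP.del r (by omega)).oct i y hi
    rwa [e _ _ (by omega), e _ _ (by omega), e _ _ (by omega)] at this
  · intro r hr ih _ i y hi
    rcases lt_or_ge y r with hy | hy
    · exact (consistency hP hQ e r hr (ih hr) i hi.le y hy.le).2.2 hi hy
    · have hp := (hP.hive r (by omega)).top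
      have hq := (hQ.hive r (by omega)).top
      rw [hp _ _ (by omega) (by omega), hp _ _ (by omega) (by omega), hp _ _ (by omega) (by omega),
        hq _ _ (by omega) (by omega), hq _ _ (by omega) (by omega), hq _ _ (by omega) (by omega)]
      rfl

/-- The partner of the first `m` rows is the full deletion of the partner of the first
`m + 1` rows. -/
theorem partner_del (hP : Family (m + 1) len P) (hQ : Family m len Q)
    (e : ∀ i y, i ≤ m → P (m + 1) i y = Q m i y) :
    Del m (partner len P) (partner len Q) where
  top i y _ hy := partner_of_ge _ _ hy
  last k hk := by
    rw [partner_of_le _ _ hk, partner_of_le _ _ (by omega), partner_of_le _ _ (by omega),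
      ← e _ _ le_rfl, ← e _ _ hk]
    ring
  oct r k hr := by
    rcases lt_trichotomy k r with hk | rfl | hk
    · rw [partner_of_le _ _ (by omega), partner_of_le _ _ (by omega), partner_of_le _ _ (by omega),
        partner_of_le _ _ (by omega), partner_of_le _ _ (by omega), partner_of_le _ _ (by omega)]
      have := (consistency hP hQ e r hr (oct_between hP hQ e (r + 1) hr) k hk.le 0 (by omega)).1 hk
      have := (hP.del r (by omega)).last 0 (by omega)
      have := (hQ.del r (by omega)).last 0 (by omega)
      omega
    · rw [partner_of_ge _ _ (by omega), partner_of_ge _ _ (by omega), partner_of_ge _ _ (by omega),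
        partner_of_ge _ _ (by omega), partner_of_ge _ _ (by omega), partner_of_le _ _ (by omega),
        lenSum_succ]
      -- On the diagonal all terms vanish except one in the minimum, a number of empty cells, which
      -- is nonnegative.
      have := (hP.hive (k + 1) (by omega)).inner k (by omega)
      omega
    · rw [partner_of_ge _ _ (by omega), partner_of_ge _ _ (by omega), partner_of_ge _ _ (by omega),
        partner_of_ge _ _ (by omega), partner_of_ge _ _ (by omega), partner_of_ge _ _ (by omega)]
      rfl

/-- Forming the partner twice gives back the original hive. -/
theorem partner_partner {n : ℕ} {G : ℕ → ℕ → ℤ} {F : ℕ → ℕ → ℕ → ℕ → ℤ} {W : ℕ → ℕ → ℕ → ℤ}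
    (hF : ∀ m, m ≤ n → Family m len (F m)) (hG : ∀ m i y, m ≤ n → i ≤ m → F m m i y = G i y)
    (hW : Family n len W) (e : ∀ i y, i ≤ n → W n i y = partner len (F n) i y)
    (r : ℕ) (hr : r ≤ n) (k : ℕ) : partner len W r k = G r k := by
  have key : ∀ m, m ≤ n → ∀ i y, i ≤ m → W m i y = partner len (F m) i y := by
    intro m hm
    refine down_induction (n := n)
      (p := fun m => m ≤ n → ∀ i y, i ≤ m → W m i y = partner len (F m) i y) ?_ ?_ m hm
    · intro m h1 h2
      obtain rfl : m = n := by omega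
      exact e
    · intro m hm ih _ i y hi
      refine (hW.del m hm).unique (partner_del (hF (m + 1) hm) (hF m hm.le) ?_) (ih hm) i y hi
      intro i y hi
      rw [hG _ _ _ hm (by omega), hG _ _ _ hm.le hi]
  rcases le_or_gt k r with hk | hk
  -- `W r k 0` is the number of empty cells in the first `k` rows of `T` truncated to `r` rows and
  -- deleted down to level `k`. There `last_eq` gives the number of letters as `G r 0 - G r k`, and
  -- the row lengths cancel.
  · have h0 := hF r hr
    rw [partner_of_le _ _ hk, key r hr r 0 le_rfl, key r hr k 0 hk, partner_of_le _ _ (by omega),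
      partner_of_le _ _ (by omega), (h0.hive r le_rfl).top 0 0 (by omega) le_rfl,
      h0.last_eq k hk 0 (by omega), hG _ _ _ hr le_rfl, hG _ _ _ hr le_rfl,
      (h0.hive k hk).top 0 0 (by omega) le_rfl]
    simp
  · rw [partner_of_ge _ _ hk.le, ← hG r r k hr le_rfl]
    exact (((hF r hr).hive r le_rfl).top r k le_rfl hk.le).symm

end Family

/-! ### Row bumping in terms of hives -/

namespace Hive

variable {n : ℕ} {len : ℕ → ℕ} {G : ℕ → ℕ → ℤ}

theorem row_anti (h : Hive n len G) {i : ℕ} (hi : i < n) {y z : ℕ} (hyz : y ≤ z) :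
    G (i + 1) z - G i z ≤ G (i + 1) y - G i y := by
  induction z, hyz using Nat.le_induction with
  | base => exact le_rfl
  | succ z _ ih =>
    have := h.row i z hi
    omega

theorem row_nonneg (h : Hive n len G) {i : ℕ} (hi : i < n) (y : ℕ) : 0 ≤ G (i + 1) y - G i y := by
  have := h.row_anti hi (le_max_left y (i + 1))
  rw [h.top (i + 1) _ hi (le_max_right _ _), h.top i _ hi.le (by omega)] at this
  omega

theorem row_le (h : Hive n len G) {i : ℕ} (hi : i < n) (y : ℕ) :
    G (i + 1) y - G i y ≤ len (i + 1) := by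
  have := h.row_anti hi (Nat.zero_le y)
  have := h.inner i hi
  omega

end Hive

/-- In the first `n` rows of `T`, the number of letters `> y` in row `i + 1` is
`G (i + 1) y - G i y`, and the rows are weakly increasing. -/
def Rep (n : ℕ) (T : Filling) (G : ℕ → ℕ → ℤ) : Prop :=
  ∀ i j y, i < n → 1 ≤ j → j ≤ T.len (i + 1) →
    (y < T.entry (i + 1) j ↔ (T.len (i + 1) : ℤ) + G i y < j + G (i + 1) y)

theorem Rep.mono {n m : ℕ} {T : Filling} {G : ℕ → ℕ → ℤ} (h : Rep n T G) (hm : m ≤ n) :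
    Rep m T G := fun i j y hi => h i j y (by omega)

/-- The sequence of letters `D a` entering the rows `a ≤ n` of a tableau with hive `G` during a
deletion. -/
structure Bumping (n : ℕ) (G : ℕ → ℕ → ℤ) (D : ℕ → ℕ) : Prop where
  zero : D 0 = 0
  halt : ∀ a, a < n → D (a + 1) = 0 → D a = 0
  next : ∀ a, a < n → 0 < D (a + 1) → ∀ y, y < D a ↔
    G (a + 1) (D (a + 1) - 1) - G a (D (a + 1) - 1) < G (a + 1) y - G a y

/-- The hive after a deletion with entering letters `D`. -/
def bumped (G : ℕ → ℕ → ℤ) (D : ℕ → ℕ) (i y : ℕ) : ℤ := G i y + if y < D i then 1 else 0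

theorem rightmostLess_spec {n : ℕ} {T : Filling} {G : ℕ → ℕ → ℤ} (hG : Hive n T.len G) {i : ℕ}
    (hi : i < n) (hT : Rep (i + 1) T G) {x : ℕ}
    (h : G (i + 1) x - G i x < T.len (i + 1)) :
    1 ≤ T.rightmostLess (i + 1) (x + 1) ∧ T.rightmostLess (i + 1) (x + 1) ≤ T.len (i + 1) ∧
      (T.rightmostLess (i + 1) (x + 1) : ℤ) = T.len (i + 1) - (G (i + 1) x - G i x) := by
  have h0 := hG.row_nonneg hi x
  obtain ⟨p, hp⟩ : ∃ p : ℕ, (p : ℤ) = T.len (i + 1) - (G (i + 1) x - G i x) :=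
    ⟨(T.len (i + 1) - (G (i + 1) x - G i x)).toNat, by omega⟩
  have key : T.rightmostLess (i + 1) (x + 1) = p := by
    unfold Filling.rightmostLess
    rw [Nat.findGreatest_eq_iff]
    refine ⟨by omega, fun _ => ⟨by omega, ?_⟩, ?_⟩
    · have := hT i p x (by omega) (by omega) (by omega)
      omega
    · rintro j hj hj' ⟨h1, h2⟩
      have := hT i j x (by omega) h1 hj'
      omega
  omega

theorem bumpUp_succ (k x : ℕ) (T : Filling) : bumpUp (k + 1) x T =
    if T.entry (k + 1) (T.rightmostLess (k + 1) x) = 0 then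
      (T.setEntry (k + 1) (T.rightmostLess (k + 1) x) x, k + 1)
    else bumpUp k (T.entry (k + 1) (T.rightmostLess (k + 1) x))
      (T.setEntry (k + 1) (T.rightmostLess (k + 1) x) x) := rfl

/-- The replaced entry stands immediately left of the entries `≥ x + 1`, so it exceeds `y` exactly
when more entries exceed `y` than exceed `x`. -/
theorem lt_replaced_iff {n : ℕ} {T : Filling} {G : ℕ → ℕ → ℤ} (hG : Hive n T.len G) {i : ℕ}
    (hi : i < n) (hT : Rep (i + 1) T G) {x : ℕ}
    (h : G (i + 1) x - G i x < T.len (i + 1)) (y : ℕ) :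
    y < T.entry (i + 1) (T.rightmostLess (i + 1) (x + 1)) ↔
      G (i + 1) x - G i x < G (i + 1) y - G i y := by
  obtain ⟨h1, h2, h3⟩ := rightmostLess_spec hG hi hT h
  rw [hT i _ y (by omega) h1 h2, h3]
  omega

theorem row_replace {n : ℕ} {T : Filling} {G : ℕ → ℕ → ℤ} (hG : Hive n T.len G) {i : ℕ}
    (hi : i < n) (hT : Rep (i + 1) T G) {x z : ℕ}
    (h : G (i + 1) x - G i x < T.len (i + 1))
    (hz : z = T.entry (i + 1) (T.rightmostLess (i + 1) (x + 1)))
    (j y : ℕ) (hj : 1 ≤ j) (hj' : j ≤ T.len (i + 1)) :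
    y < (T.setEntry (i + 1) (T.rightmostLess (i + 1) (x + 1)) (x + 1)).entry (i + 1) j ↔
      (T.len (i + 1) : ℤ) + (G i y + if y < z then 1 else 0) <
        j + (G (i + 1) y + if y < x + 1 then 1 else 0) := by
  obtain ⟨h1, h2, h3⟩ := rightmostLess_spec hG hi hT h
  have h4 := lt_replaced_iff hG hi hT h y
  have h5 := hT i j y (by omega) hj hj'
  rw [← hz] at h4
  have h6 : y ≤ x → G (i + 1) x - G i x ≤ G (i + 1) y - G i y := hG.row_anti hi
  have h7 : x ≤ y → G (i + 1) y - G i y ≤ G (i + 1) x - G i x := hG.row_anti hi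
  generalize T.rightmostLess (i + 1) (x + 1) = p at *
  simp only [Filling.setEntry, true_and]
  split_ifs <;> omega

theorem setEntry_entry_of_ne (T : Filling) {i a : ℕ} (j x b : ℕ) (h : a ≠ i) :
    (T.setEntry i j x).entry a b = T.entry a b := by
  simp [Filling.setEntry, h]

theorem bumpUp_spec_of_zero {n : ℕ} {G : ℕ → ℕ → ℤ} (i : ℕ) (hi : i < n) (T : Filling)
    (hG : Hive n T.len G) (hT : Rep (i + 1) T G) (x : ℕ)
    (h : G (i + 1) x - G i x < T.len (i + 1))
    (hz : T.entry (i + 1) (T.rightmostLess (i + 1) (x + 1)) = 0) :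
    ∃ D, Bumping (i + 1) G D ∧ D (i + 1) = x + 1 ∧
      (bumpUp (i + 1) (x + 1) T).1.len = T.len ∧
      (∀ a b, i + 1 < a → (bumpUp (i + 1) (x + 1) T).1.entry a b = T.entry a b) ∧
      Rep (i + 1) (bumpUp (i + 1) (x + 1) T).1 (bumped G D) ∧
      ∀ a, a ≤ i + 1 → ((bumpUp (i + 1) (x + 1) T).2 ≤ a ↔ 0 < D a) := by
  rw [bumpUp_succ, if_pos hz]
  refine ⟨fun a => if a = i + 1 then x + 1 else 0, ⟨?_, ?_, ?_⟩, if_pos rfl, rfl, ?_, ?_, ?_⟩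
  · simp
  · intro a ha _
    exact if_neg (by omega)
  · intro a ha h0 y
    have ha : a = i := by
      by_contra hne
      rw [if_neg (by omega)] at h0
      omega
    subst ha
    have := lt_replaced_iff hG hi hT h y
    rw [hz] at this
    simpa using this
  · intro a b ha
    exact setEntry_entry_of_ne _ _ _ _ (by omega)
  · intro a j y ha hj hj'
    rcases (Nat.lt_succ_iff.mp ha).lt_or_eq with ha | rfl
    · rw [setEntry_entry_of_ne _ _ _ _ (by omega), hT a j y (by omega) hj hj']
      simp [bumped, Filling.setEntry, show ¬ a = i + 1 by omega, show ¬ a = i by omega]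
    · have := row_replace hG hi hT h hz.symm j y hj hj'
      rw [this]
      simp [bumped, Filling.setEntry]
  · intro a ha
    dsimp only
    split_ifs <;> omega

theorem bumpUp_spec {n : ℕ} {G : ℕ → ℕ → ℤ} (i : ℕ) (hi : i < n) (T : Filling)
    (hG : Hive n T.len G) (hT : Rep (i + 1) T G) (x : ℕ) (hx : x ≤ i)
    (h : G (i + 1) x - G i x < T.len (i + 1)) :
    ∃ D, Bumping (i + 1) G D ∧ D (i + 1) = x + 1 ∧
      (bumpUp (i + 1) (x + 1) T).1.len = T.len ∧
      (∀ a b, i + 1 < a → (bumpUp (i + 1) (x + 1) T).1.entry a b = T.entry a b) ∧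
      Rep (i + 1) (bumpUp (i + 1) (x + 1) T).1 (bumped G D) ∧
      ∀ a, a ≤ i + 1 → ((bumpUp (i + 1) (x + 1) T).2 ≤ a ↔ 0 < D a) := by
  induction i generalizing T x with
  | zero =>
    refine bumpUp_spec_of_zero 0 hi T hG hT x h ?_
    have := lt_replaced_iff hG hi hT h 0
    obtain rfl : x = 0 := by omega
    omega
  | succ i ih =>
    by_cases hz : T.entry (i + 2) (T.rightmostLess (i + 2) (x + 1)) = 0
    · exact bumpUp_spec_of_zero (i + 1) hi T hG hT x h hz
    obtain ⟨z, hz'⟩ := Nat.exists_eq_succ_of_ne_zero hz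
    have hlt := lt_replaced_iff hG hi hT h
    rw [show i + 1 + 1 = i + 2 from rfl, hz'] at hlt
    have hlt0 := (hlt z).1 (by omega)
    have hlt1 := hlt (z + 1)
    have hzx : z < x := by
      by_contra hcon
      have := hG.row_anti hi (not_lt.mp hcon)
      have e4 : G (i + 1 + 1) = G (i + 2) := rfl
      rw [e4] at this
      omega
    set T' := T.setEntry (i + 2) (T.rightmostLess (i + 2) (x + 1)) (x + 1) with hT'
    have hrec : bumpUp (i + 2) (x + 1) T = bumpUp (i + 1) (z + 1) T' := by
      rw [bumpUp_succ, if_neg hz, hz']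
    have hR' : Rep (i + 1) T' G := by
      intro a j y ha hj hj'
      rw [setEntry_entry_of_ne _ _ _ _ (by omega)]
      exact hT a j y (by omega) hj hj'
    -- The replaced letter `z + 1` was in row `i + 2`, so by column strictness row `i + 1` has an
    -- entry `≤ z`, and the bump can continue.
    obtain ⟨D, hD, hDi, hlen, hout, hR, ht⟩ := ih (by omega) T' hG hR' z (by omega) (by
      have h1 := hG.col i z hi
      have h2 := hG.row_le hi z
      have e4 : G (i + 1 + 1) = G (i + 2) := rfl
      have e5 : T.len (i + 1 + 1) = T.len (i + 2) := rfl
      have e6 : T'.len = T.len := rfl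
      rw [e4, e5] at h2
      rw [e6]
      omega)
    rw [show i + 1 + 1 = i + 2 from rfl, hrec]
    refine ⟨fun a => if a = i + 2 then x + 1 else D a, ⟨?_, ?_, ?_⟩, if_pos rfl, hlen, ?_, ?_, ?_⟩
    · simpa using hD.zero
    · intro a ha h0
      rcases (Nat.lt_succ_iff.mp ha).lt_or_eq with ha | rfl
      · rw [if_neg (by omega)] at h0 ⊢
        exact hD.halt a ha h0
      · simp at h0
    · intro a ha h0 y
      rcases (Nat.lt_succ_iff.mp ha).lt_or_eq with ha | rfl
      · rw [if_neg (by omega)] at h0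
        rw [if_neg (by omega), if_neg (by omega)]
        exact hD.next a ha h0 y
      · rw [if_neg (by omega), if_pos rfl, hDi]
        exact hlt y
    · intro a b ha
      rw [hout a b (by omega), setEntry_entry_of_ne _ _ _ _ (by omega)]
    · intro a j y ha hj hj'
      rw [hlen] at hj' ⊢
      rcases (Nat.lt_succ_iff.mp ha).lt_or_eq with ha | rfl
      · have := hR a j y ha hj (by rwa [hlen])
        rw [hlen] at this
        rw [this]
        simp only [bumped, if_neg (show ¬ a = i + 2 by omega),
          if_neg (show ¬ a + 1 = i + 2 by omega)]
      · rw [hout _ _ (by omega)]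
        have := row_replace hG hi hT h hz'.symm j y hj hj'
        simp only [bumped, if_neg (show ¬ i + 1 = i + 2 by omega), if_pos, hDi]
        exact this
    · intro a ha
      rcases ha.lt_or_eq with ha | rfl
      · dsimp only
        rw [if_neg (by omega), ht a (by omega)]
      · have := (ht (i + 1) le_rfl).2 (by omega)
        simp
        omega


/-! ### One more bump preserves the octahedron relation -/

theorem Flow.anti_of_le {n : ℕ} {len : ℕ → ℕ} {G P : ℕ → ℕ → ℤ} (h : Flow n G P)
    (hG : Hive (n + 1) len G) (i : ℕ) (hi : i ≤ n) {y z : ℕ} (hyz : y ≤ z) :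
    P i z + G i y ≤ P i y + G i z := by
  induction z, hyz using Nat.le_induction with
  | base => exact le_rfl
  | succ z _ ih =>
    have := h.anti hG i hi z
    omega

namespace Bumping

variable {n : ℕ} {len : ℕ → ℕ} {G P : ℕ → ℕ → ℤ} {D : ℕ → ℕ}

theorem lt_succ (h : Bumping n P D) {a : ℕ} (ha : a < n) (h0 : 0 < D (a + 1)) :
    D a < D (a + 1) := by
  have := h.next a ha h0 (D (a + 1) - 1)
  omega

theorem le_self (h : Bumping n P D) (hn : D n ≤ n) (a : ℕ) (ha : a ≤ n) : D a ≤ a := by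
  refine down_induction (n := n) (p := fun a => a ≤ n → D a ≤ a) ?_ ?_ a ha
  · intro a h1 h2
    obtain rfl : a = n := by omega
    exact hn
  · intro a ha ih _
    have := ih ha
    rcases Nat.eq_zero_or_pos (D (a + 1)) with h0 | h0
    · rw [h.halt a ha h0]
      omega
    · have := h.lt_succ ha h0
      omega

/-- The replaced letter `w + 1` occurs in row `i + 1`, so one inequality is strict. It forces the
minimum in the recurrence at `(i, w)` to be its first term alone. -/
theorem strict (h : Bumping n P D) {i : ℕ} (hi : i < n)
    {J : ℤ} (hJ : ∀ y, y < D (i + 1) → P (i + 1) y = G (i + 1) y + J) {w : ℕ}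
    (hw : D i = w + 1) :
    P i w + G (i + 1) (w + 1) < P i (w + 1) + G (i + 1) w := by
  have h0 : 0 < D (i + 1) := by
    by_contra hcon
    have := h.halt i hi (by omega)
    omega
  have h1 := h.lt_succ hi h0
  have h2 := h.next i hi h0 w
  have h3 := h.next i hi h0 (w + 1)
  have h4 := hJ w (by omega)
  have h5 := hJ (w + 1) (by omega)
  omega

/-- Here `J` is the number of letters bumped so far: all of them entered row `i`, and as letters at
least `D i`. This is why terminating row numbers increase weakly. Going up a row, `strict` gives
equality at the largest `y < D i`; `anti` and the recurrence enclose the other values. -/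
theorem flow_const (h : Bumping n P D) (hf : Flow n G P)
    (hG : Hive (n + 1) len G) {J : ℤ} (hJ : ∀ y, y < D n → P n y = G n y + J)
    (i : ℕ) (hi : i ≤ n) (y : ℕ) (hy : y < D i) : P i y = G i y + J := by
  refine down_induction (n := n)
    (p := fun i => i ≤ n → ∀ y, y < D i → P i y = G i y + J) ?_ ?_ i hi y hy
  · intro i h1 h2
    obtain rfl : i = n := by omega
    exact hJ
  · intro i hi ih _ y hy
    have h0 : 0 < D (i + 1) := by
      by_contra hcon
      have := h.halt i hi (by omega)
      omega
    obtain ⟨w, hw⟩ : ∃ w, D i = w + 1 := ⟨D i - 1, by omega⟩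
    have h1 := h.lt_succ hi h0
    have h2 := h.strict hi (ih hi) hw
    have h3 := hf.oct i w hi
    have h4 := ih hi (w + 1) (by omega)
    have h5 := hf.anti_of_le hG i hi.le (show y ≤ w by omega)
    have h6 := hf.le_left i y hi
    have h7 := ih hi (y + 1) (by omega)
    omega

theorem oct (h : Bumping n P D) (hP : Hive n len P) (hf : Flow n G P)
    (hG : Hive (n + 1) len G) {J : ℤ} (hJ : ∀ y, y < D n → P n y = G n y + J) :
    Oct n G (bumped P D) := by
  intro i y hi
  have h1 := hf.oct i y hi
  have hc := fun y => h.flow_const hf hG hJ (i + 1) hi y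
  rcases Nat.eq_zero_or_pos (D (i + 1)) with h0 | h0
  · have := h.halt i hi h0
    simp [bumped, h0, this, h1]
  have hlt := h.lt_succ hi h0
  simp only [bumped]
  by_cases c1 : y + 1 < D i
  · rw [if_pos (by omega), if_pos (by omega), if_pos (by omega)]
    omega
  by_cases c2 : y + 1 = D i
  · rw [if_pos (by omega), if_pos (by omega), if_neg (by omega)]
    -- The left side and the first term rise by one; the second does not, but was strictly larger.
    have := h.strict hi hc c2.symm
    omega
  by_cases c3 : y + 1 < D (i + 1)
  · rw [if_neg (by omega), if_pos (by omega), if_neg (by omega)]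
    -- Only the first term rises. No letter `y + 1` occurs in row `i + 1`, so the second term
    -- already attains the minimum.
    have h2 := h.next i hi h0 y
    have h3 := hP.row_anti hi (show y + 1 ≤ D (i + 1) - 1 by omega)
    have h4 := hc y (by omega)
    have h5 := hc (y + 1) (by omega)
    omega
  · rw [if_neg (by omega), if_neg (by omega), if_neg (by omega)]
    omega

end Bumping

/-! ### Repeated deletion in one row -/

/-- The state `T'` reached from `T` after `j` deletions in row `n + 1`, with hive `P`. -/
structure Deleting (n j : ℕ) (T T' : Filling) (G P : ℕ → ℕ → ℤ) : Prop where
  oct : Oct n G P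
  top : ∀ i y, i ≤ n → i ≤ y → P i y = 0
  len_eq : ∀ a, a ≠ n + 1 → T'.len a = T.len a
  len_last : T'.len (n + 1) = T.len (n + 1) - j
  entry_last : ∀ b, b ≤ T.len (n + 1) - j → T'.entry (n + 1) b = T.entry (n + 1) b
  rep : Rep n T' P
  last : ∀ y, y ≤ n → P n y = G n y + min (j : ℤ) (G (n + 1) y - G n y) -
    min (j : ℤ) (G (n + 1) n - G n n)
  term : ∀ k i, 1 ≤ k → k ≤ j → i ≤ n →
    (termRow (n + 1) T k ≤ i ↔ (k : ℤ) ≤ G (n + 1) n - G n n + P i 0 - G i 0)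
  term_le : ∀ k, 1 ≤ k → k ≤ j → termRow (n + 1) T k ≤ n + 1

namespace Deleting

variable {n j : ℕ} {T T' : Filling} {G P : ℕ → ℕ → ℤ}

theorem flow (h : Deleting n j T T' G P) (hG : Hive (n + 1) T.len G) : Flow n G P where
  oct := h.oct
  top := h.top
  last_anti y := by
    rcases lt_or_ge y n with hy | hy
    · have := h.last y hy.le
      have := h.last (y + 1) hy
      have := hG.row n y (by omega)
      omega
    · have := h.top n y le_rfl hy
      have := h.top n (y + 1) le_rfl (by omega)
      have := hG.top n y (by omega) hy
      have := hG.top n (y + 1) (by omega) (by omega)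
      omega
  last_le y := by
    rcases lt_or_ge y n with hy | hy
    · have := h.last y hy.le
      have := h.last (y + 1) hy
      have := hG.row n y (by omega)
      omega
    · have := h.top n y le_rfl hy
      have := h.top n (y + 1) le_rfl (by omega)
      have := hG.anti (n + 1) (by omega) y
      omega

theorem hive (h : Deleting n j T T' G P) (hG : Hive (n + 1) T.len G) : Hive n T.len P :=
  (h.flow hG).hive hG (fun y => h.top 0 y (Nat.zero_le _) (Nat.zero_le _))

theorem init (hG : Hive (n + 1) T.len G) (hT : Rep (n + 1) T G) : Deleting n 0 T T G G where
  oct i y hi := by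
    have := hG.row i y (by omega)
    omega
  top i y hi := hG.top i y (by omega)
  len_eq _ _ := rfl
  len_last := rfl
  entry_last _ _ := rfl
  rep := hT.mono (by omega)
  last y hy := by
    have := hG.row_nonneg (i := n) (by omega) y
    have := hG.row_nonneg (i := n) (by omega) n
    omega
  term k i h1 h2 := by omega
  term_le k h1 h2 := by omega

theorem lt_entry_iff (h : Deleting n j T T' G P) (hT : Rep (n + 1) T G)
    (hj : j < T.len (n + 1)) (y : ℕ) :
    y < T'.entry (n + 1) (T'.len (n + 1)) ↔ (j : ℤ) < G (n + 1) y - G n y := by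
  rw [h.len_last, h.entry_last _ le_rfl, hT n _ y (by omega) (by omega) (by omega)]
  omega

theorem removeLast_len (h : Deleting n j T T' G P) :
    (∀ a, a ≠ n + 1 → (T'.removeLast (n + 1)).len a = T.len a) ∧
      (T'.removeLast (n + 1)).len (n + 1) = T.len (n + 1) - (j + 1) := by
  constructor
  · intro a ha
    simp [Filling.removeLast, ha, h.len_eq]
  · simp [Filling.removeLast, h.len_last]
    omega

theorem removeLast_entry (h : Deleting n j T T' G P) (hj : j < T.len (n + 1)) :
    (∀ a b, a ≠ n + 1 → (T'.removeLast (n + 1)).entry a b = T'.entry a b) ∧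
      ∀ b, b ≤ T.len (n + 1) - (j + 1) →
        (T'.removeLast (n + 1)).entry (n + 1) b = T.entry (n + 1) b := by
  constructor
  · intro a b ha
    simp [Filling.removeLast, ha]
  · intro b hb
    rw [← h.entry_last b (by omega)]
    simp only [Filling.removeLast, true_and, h.len_last]
    rw [if_neg (by omega)]

theorem removeLast_rep (h : Deleting n j T T' G P) (hj : j < T.len (n + 1)) :
    Rep n (T'.removeLast (n + 1)) P := by
  intro a b y ha hb hb'
  rw [h.removeLast_len.1 _ (by omega)] at hb' ⊢
  rw [(h.removeLast_entry hj).1 _ _ (by omega), h.rep a b y ha hb, h.len_eq _ (by omega)]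
  rwa [h.len_eq _ (by omega)]

/-- This guarantees an entry smaller than `x + 1` in the row above, although that row has been
changed by `j` deletions: depending on the term attaining the minimum, old column strictness or
`interlace` provides it. -/
theorem bump_lt (h : Deleting (n + 1) j T T' G P) (hG : Hive (n + 2) T.len G)
    (hj : j < T.len (n + 2)) (x : ℕ) (hx : x ≤ n) (h1 : (j : ℤ) < G (n + 2) x - G (n + 1) x)
    (h2 : G (n + 2) (x + 1) - G (n + 1) (x + 1) ≤ j) :
    P (n + 1) x - P n x < T.len (n + 1) := by
  have f := h.flow hG
  have k1 := f.oct n x (by omega)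
  have k2 := f.interlace hG n (by omega) (x + 1)
  have k3 := hG.col n x (by omega)
  have k4 := h.last x (by omega)
  have k5 := h.last (x + 1) (by omega)
  have e : G (n + 1 + 1) = G (n + 2) := rfl
  have k6 := hG.row_anti (i := n + 1) (by omega) (show x + 1 ≤ n + 1 by omega)
  rw [e] at k4 k5 k6
  omega

theorem succ (h : Deleting n j T T' G P) (hG : Hive (n + 1) T.len G) (hT : Rep (n + 1) T G)
    (hj : j < T.len (n + 1)) (hτ : termRow (n + 1) T (j + 1) = (deleteLast (n + 1) T').2) :
    ∃ P', Deleting n (j + 1) T (deleteLast (n + 1) T').1 G P' := by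
  have f := h.flow hG
  have hx := h.lt_entry_iff hT hj
  have A0 := hG.row_nonneg (i := n) (by omega)
  have hA : ∀ y, y ≤ n → G (n + 1) n - G n n ≤ G (n + 1) y - G n y := fun y hy =>
    hG.row_anti (by omega) hy
  have hA0 : ∀ y, G (n + 1) y - G n y ≤ G (n + 1) 0 - G n 0 := fun y =>
    hG.row_anti (by omega) (Nat.zero_le y)
  have hle : T'.entry (n + 1) (T'.len (n + 1)) ≤ n + 1 := by
    by_contra hcon
    have := (hx (n + 1)).1 (by omega)
    rw [hG.top _ _ le_rfl le_rfl, hG.top _ _ (by omega) (by omega)] at this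
    omega
  have hmono : ∀ i, i ≤ n → G i 0 ≤ P i 0 := fun i hi => f.le hG i hi 0
  have hlast : ∀ i, i ≤ n → P i 0 + G n 0 ≤ P n 0 + G i 0 := fun i hi => f.le_last hG i hi 0
  have hl0 := h.last 0 (Nat.zero_le n)
  have hxn := hx n
  have hx0 := hx 0
  unfold deleteLast at hτ ⊢
  dsimp only at hτ ⊢
  by_cases c1 : T'.entry (n + 1) (T'.len (n + 1)) = n + 1
  · rw [if_pos c1] at hτ ⊢
    refine ⟨P, h.oct, h.top, h.removeLast_len.1, h.removeLast_len.2, (h.removeLast_entry hj).2,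
      h.removeLast_rep hj, ?_, ?_, ?_⟩
    · intro y hy
      have := h.last y hy
      have := hA y hy
      push_cast
      omega
    · intro k i h1 h2 hi
      rcases h2.lt_or_eq with h2 | rfl
      · exact h.term k i h1 (by omega) hi
      · rw [hτ]
        have := hmono i hi
        push_cast
        omega
    · intro k h1 h2
      rcases h2.lt_or_eq with h2 | rfl
      · exact h.term_le k h1 (by omega)
      · omega
  by_cases c2 : T'.entry (n + 1) (T'.len (n + 1)) = 0
  · rw [if_neg c1, if_pos c2] at hτ ⊢
    refine ⟨P, h.oct, h.top, h.removeLast_len.1, h.removeLast_len.2, (h.removeLast_entry hj).2,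
      h.removeLast_rep hj, ?_, ?_, ?_⟩
    · intro y hy
      have := h.last y hy
      have := hA0 y
      have := hA0 n
      push_cast
      omega
    · intro k i h1 h2 hi
      rcases h2.lt_or_eq with h2 | rfl
      · exact h.term k i h1 (by omega) hi
      · rw [hτ]
        have := hlast i hi
        have := hA0 n
        push_cast
        omega
    · intro k h1 h2
      rcases h2.lt_or_eq with h2 | rfl
      · exact h.term_le k h1 (by omega)
      · omega
  obtain ⟨x, hxe⟩ : ∃ x, T'.entry (n + 1) (T'.len (n + 1)) = x + 1 := ⟨_, (Nat.succ_pred c2).symm⟩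
  rw [if_neg c1, if_neg c2, hxe] at hτ ⊢
  rw [hxe] at hx c1 hle hxn hx0
  clear c2
  obtain ⟨i, rfl⟩ : ∃ i, n = i + 1 := ⟨n - 1, by omega⟩
  have hR := h.removeLast_rep hj
  have hH : Hive (i + 1) (T'.removeLast (i + 1 + 1)).len P :=
    (h.hive hG).congr_len fun a ha => h.removeLast_len.1 _ (by omega)
  have hl : (T'.removeLast (i + 1 + 1)).len (i + 1) = T.len (i + 1) :=
    h.removeLast_len.1 _ (by omega)
  obtain ⟨D, hD, hDi, hlen, hout, hrep, ht⟩ := bumpUp_spec i (by omega) _ hH hR x (by omega) (by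
    rw [hl]
    exact h.bump_lt hG hj x (by omega) ((hx x).1 (by omega))
      (not_lt.mp fun hcon => by simpa using (hx (x + 1)).2 hcon))
  rw [show i + 1 + 1 - 1 = i + 1 from rfl] at hτ ⊢
  -- Of the `j` deleted letters, those equal to the row number were dropped. All others were bumped,
  -- and are at least the current letter, so each is counted for `y < D (i + 1)`.
  have hJ : ∀ y, y < D (i + 1) → P (i + 1) y = G (i + 1) y +
      (j - (G (i + 1 + 1) (i + 1) - G (i + 1) (i + 1))) := by
    intro y hy
    have := h.last y (by omega)
    have := hx y
    omega
  have hconst := hD.flow_const f hG hJ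
  refine ⟨bumped P D, hD.oct (h.hive hG) f hG hJ, ?_, ?_, ?_, ?_, hrep, ?_, ?_, ?_⟩
  · intro a y ha hay
    have := hD.le_self (by omega) a ha
    simp only [bumped]
    rw [if_neg (by omega), h.top a y ha hay, add_zero]
  · intro a ha
    rw [hlen, h.removeLast_len.1 a ha]
  · rw [hlen, h.removeLast_len.2]
  · intro b hb
    rw [hout _ _ (by omega), (h.removeLast_entry hj).2 b hb]
  · intro y hy
    have h1 := h.last y hy
    have h2 := hx y
    simp only [bumped, hDi]
    push_cast
    split_ifs <;> omega
  · intro k a h1 h2 ha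
    have h3 := hmono a ha
    have h4 := hlast a ha
    have h6 : 0 < D a → _ := hconst a ha 0
    simp only [bumped]
    rcases h2.lt_or_eq with h2 | rfl
    · have := h.term k a h1 (by omega) ha
      split_ifs <;> omega
    · rw [hτ]
      have := ht a ha
      push_cast
      split_ifs <;> omega
  · intro k h1 h2
    rcases h2.lt_or_eq with h2 | rfl
    · exact h.term_le k h1 (by omega)
    · rw [hτ]
      have := (ht (i + 1) le_rfl).2 (by omega)
      omega

end Deleting

theorem deleteIter_spec {n : ℕ} {T : Filling} {G : ℕ → ℕ → ℤ} (hG : Hive (n + 1) T.len G)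
    (hT : Rep (n + 1) T G) (j : ℕ) (hj : j ≤ T.len (n + 1)) :
    ∃ P, Deleting n j T (deleteIter (n + 1) j T) G P := by
  induction j with
  | zero => exact ⟨G, Deleting.init hG hT⟩
  | succ j ih =>
    obtain ⟨P, hP⟩ := ih (by omega)
    have : deleteIter (n + 1) (j + 1) T = (deleteLast (n + 1) (deleteIter (n + 1) j T)).1 :=
      Function.iterate_succ_apply' _ _ _
    rw [this]
    exact hP.succ hG hT (by omega) rfl

/-- The full deletion of row `n + 1`, and its terminating row numbers, in terms of hives. -/
theorem fullDelete_spec {n : ℕ} {T : Filling} {G : ℕ → ℕ → ℤ} (hG : Hive (n + 1) T.len G)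
    (hT : Rep (n + 1) T G) :
    ∃ P, Del n G P ∧ Hive n T.len P ∧ Rep n (fullDelete (n + 1) T) P ∧
      (∀ a, a ≠ n + 1 → (fullDelete (n + 1) T).len a = T.len a) ∧
      (∀ k i, 1 ≤ k → k ≤ T.len (n + 1) → i ≤ n → (termRow (n + 1) T k ≤ i ↔
        (k : ℤ) ≤ G (n + 1) n + P i 0 - G i 0)) ∧
      ∀ k, 1 ≤ k → k ≤ T.len (n + 1) → termRow (n + 1) T k ≤ n + 1 := by
  obtain ⟨P, h⟩ := deleteIter_spec hG hT _ le_rfl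
  have h0 := hG.top n n (by omega) le_rfl
  refine ⟨P, ⟨h.oct, h.top, ?_⟩, h.hive hG, h.rep, h.len_eq, ?_, h.term_le⟩
  · intro y hy
    have := h.last y hy
    have := hG.row_le (i := n) (by omega) y
    have := hG.row_le (i := n) (by omega) n
    omega
  · intro k i h1 h2 hi
    have := h.term k i h1 h2 hi
    omega


/-! ### All rows: the filling produced by the algorithm -/

/-- The specification of `allSteps`: it produces the partner hive. -/
theorem allSteps_spec {n : ℕ} {len : ℕ → ℕ} {T : Filling} (S : Filling) {G : ℕ → ℕ → ℤ}
    (hl : ∀ a, a < n → T.len (a + 1) = len (a + 1)) (hG : Hive n len G) (hT : Rep n T G) :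
    ∃ F, Family n len F ∧ F n = G ∧
      (∀ a, a < n → (allSteps n (T, S)).2.len (a + 1) = len (a + 1)) ∧
      (∀ a b, a < n → ¬ (1 ≤ b ∧ b ≤ len (a + 1)) →
        (allSteps n (T, S)).2.entry (a + 1) b = 0) ∧
      (∀ a, a = 0 ∨ n < a → (allSteps n (T, S)).2.len a = S.len a ∧
        ∀ b, (allSteps n (T, S)).2.entry a b = S.entry a b) ∧
      Rep n (allSteps n (T, S)).2 (partner len F) := by
  induction n generalizing T S G with
  | zero =>
    refine ⟨fun _ => G, ⟨?_, fun _ h => by omega⟩, rfl, fun _ h => by omega, fun _ _ h => by omega,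
      fun _ _ => ⟨rfl, fun _ => rfl⟩, fun _ _ _ h => by omega⟩
    intro r hr
    obtain rfl : r = 0 := by omega
    exact hG
  | succ n ih =>
    have hG' : Hive (n + 1) T.len G := hG.congr_len hl
    obtain ⟨P, hdel, hP, hR, hlen, hterm, hterm_le⟩ := fullDelete_spec hG' hT
    have hn := hl n (by omega)
    set S₁ := S.setRow (n + 1) (T.len (n + 1)) (termRow (n + 1) T) with hS₁
    have hstep : allSteps (n + 1) (T, S) = allSteps n (fullDelete (n + 1) T, S₁) := rfl
    obtain ⟨F, hF, hFn, h1, h2, h3, h4⟩ := ih (T := fullDelete (n + 1) T) S₁ (G := P)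
      (fun a ha => by rw [hlen _ (by omega), hl a (by omega)])
      (hP.congr_len fun a ha => (hl a (by omega)).symm) hR
    rw [hstep]
    obtain ⟨h5, h6⟩ := h3 (n + 1) (Or.inr (by omega))
    have h5' : S₁.len (n + 1) = len (n + 1) := by simp [hS₁, Filling.setRow, hn]
    set F' : ℕ → ℕ → ℕ → ℤ := fun r => if r = n + 1 then G else F r with hF'
    have e1 : F' (n + 1) = G := if_pos rfl
    have e2 : ∀ r, r ≤ n → F' r = F r := fun r hr => if_neg (by omega)
    have e3 : ∀ r k, r ≤ n → partner len F' r k = partner len F r k := by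
      intro r k hr
      simp only [partner, e2 r hr]
    refine ⟨F', ⟨?_, ?_⟩, e1, ?_, ?_, ?_, ?_⟩
    · intro r hr
      rcases hr.lt_or_eq with hr | rfl
      · rw [e2 r (by omega)]
        exact hF.hive r (by omega)
      · rwa [e1]
    · intro r hr
      rcases (Nat.lt_succ_iff.mp hr).lt_or_eq with hr | rfl
      · rw [e2 r hr.le, e2 (r + 1) hr]
        exact hF.del r hr
      · rw [e1, e2 r le_rfl, hFn]
        exact hdel
    · intro a ha
      rcases (Nat.lt_succ_iff.mp ha).lt_or_eq with ha | rfl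
      · exact h1 a ha
      · rw [h5, h5']
    · intro a b ha hb
      rcases (Nat.lt_succ_iff.mp ha).lt_or_eq with ha | rfl
      · exact h2 a b ha hb
      · rw [h6, hS₁]
        simp only [Filling.setRow, if_true]
        rw [if_neg (by rwa [hn])]
    · intro a ha
      obtain ⟨h7, h8⟩ := h3 a (by omega)
      have : a ≠ n + 1 := by omega
      refine ⟨?_, fun b => ?_⟩
      · rw [h7, hS₁]
        simp [Filling.setRow, this]
      · rw [h8, hS₁]
        simp [Filling.setRow, this]
    · intro a j y ha hj hj'
      rcases (Nat.lt_succ_iff.mp ha).lt_or_eq with ha | rfl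
      · rw [e3 _ _ (by omega), e3 _ _ (by omega)]
        exact h4 a j y ha hj hj'
      · rw [h5, h5'] at hj' ⊢
        rw [h6, hS₁]
        simp only [Filling.setRow, if_true]
        rw [if_pos (by omega)]
        -- For `y` up to the level `a` below the new row, the terminating rows are read off from
        -- inner shapes; beyond it no entry exceeds `y`, as terminating rows are at most `a + 1`.
        rcases le_or_gt y a with hy | hy
        · rw [e3 _ _ le_rfl, partner_of_le _ _ hy, partner_of_le _ _ (by omega), lenSum_succ, e1,
            hFn]
          have := hterm j y hj (by omega) hy
          have := hdel.last 0 (by omega)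
          omega
        · rw [partner_of_ge _ _ (by omega), partner_of_ge _ _ (by omega)]
          have := hterm_le j hj (by omega)
          omega

/-! ### Dictionary between Littlewood–Richardson tableaux and hives -/

/-- The number of letters `> y` in row `i`. -/
def rowCount (T : Filling) (i y : ℕ) : ℕ :=
  ((Finset.Icc 1 (T.len i)).filter (fun j => y < T.entry i j)).card

/-- The number of letters `> y` in the first `r` rows. -/
def countGt (T : Filling) (r y : ℕ) : ℤ := ∑ i ∈ Finset.range r, (rowCount T (i + 1) y : ℤ)

theorem countGt_succ (T : Filling) (r y : ℕ) :
    countGt T (r + 1) y = countGt T r y + rowCount T (r + 1) y := Finset.sum_range_succ _ _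

theorem count_succ (T : Filling) (s r : ℕ) : T.count s (r + 1) = T.count s r +
    ((Finset.Icc 1 (T.len (r + 1))).filter (fun j => T.entry (r + 1) j = s)).card :=
  Finset.sum_Icc_succ_top (by omega) _

theorem count_zero_rows (T : Filling) (s : ℕ) : T.count s 0 = 0 := by simp [Filling.count]

theorem rowCount_succ (T : Filling) (i y : ℕ) : rowCount T i y = rowCount T i (y + 1) +
    ((Finset.Icc 1 (T.len i)).filter (fun j => T.entry i j = y + 1)).card := by
  unfold rowCount
  rw [← Finset.card_union_of_disjoint]
  · congr 1
    ext j
    simp only [Finset.mem_filter, Finset.mem_union, Finset.mem_Icc]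
    omega
  · rw [Finset.disjoint_filter]
    intro j _ h
    omega

theorem count_eq (T : Filling) (y r : ℕ) :
    (T.count (y + 1) r : ℤ) = countGt T r y - countGt T r (y + 1) := by
  induction r with
  | zero => simp [count_zero_rows, countGt]
  | succ r ih =>
    have := rowCount_succ T (r + 1) y
    rw [countGt_succ, countGt_succ, count_succ]
    push_cast
    omega

theorem count_mono (T : Filling) (s r : ℕ) : T.count s r ≤ T.count s (r + 1) := by
  rw [count_succ]
  omega

theorem count_eq_of_len_zero (T : Filling) (s : ℕ) {r r' : ℕ} (h : r ≤ r')
    (h0 : ∀ a, r < a → T.len a = 0) : T.count s r' = T.count s r := by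
  induction r', h using Nat.le_induction with
  | base => rfl
  | succ r' hr ih =>
    rw [count_succ, h0 (r' + 1) (by omega), ih]
    simp

theorem rowCount_le (T : Filling) (i y : ℕ) : rowCount T i y ≤ T.len i := by
  simpa [rowCount] using Finset.card_filter_le (Finset.Icc 1 (T.len i)) (fun j => y < T.entry i j)

theorem lt_entry_iff_of_sorted {T : Filling} {i : ℕ}
    (h : ∀ j, 1 ≤ j → j + 1 ≤ T.len i → T.entry i j ≤ T.entry i (j + 1)) (j y : ℕ) (hj : 1 ≤ j)
    (hj' : j ≤ T.len i) : y < T.entry i j ↔ T.len i < j + rowCount T i y := by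
  have mono : ∀ a b, 1 ≤ a → a ≤ b → b ≤ T.len i → T.entry i a ≤ T.entry i b := by
    intro a b ha hab hb
    induction b, hab using Nat.le_induction with
    | base => exact le_rfl
    | succ b hab ih => exact (ih (by omega)).trans (h b (by omega) hb)
  constructor
  · intro hy
    have : (Finset.Icc j (T.len i)).card ≤ rowCount T i y := by
      refine Finset.card_le_card fun b hb => ?_
      rw [Finset.mem_Icc] at hb
      rw [Finset.mem_filter, Finset.mem_Icc]
      exact ⟨⟨by omega, hb.2⟩, hy.trans_le (mono j b hj hb.1 hb.2)⟩
    rw [Nat.card_Icc] at this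
    omega
  · intro hlt
    by_contra hy
    have : rowCount T i y ≤ (Finset.Icc (j + 1) (T.len i)).card := by
      refine Finset.card_le_card fun b hb => ?_
      rw [Finset.mem_filter, Finset.mem_Icc] at hb
      rw [Finset.mem_Icc]
      refine ⟨?_, hb.1.2⟩
      by_contra hbj
      have := mono b j hb.1.1 (by omega) hj'
      omega
    rw [Nat.card_Icc] at this
    omega

theorem Rep.rowCount_eq {n : ℕ} {T : Filling} {G : ℕ → ℕ → ℤ} (h : Rep n T G)
    (hG : Hive n T.len G) {i : ℕ} (hi : i < n) (y : ℕ) :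
    (rowCount T (i + 1) y : ℤ) = G (i + 1) y - G i y := by
  have h0 := hG.row_nonneg hi y
  have h1 := hG.row_le hi y
  obtain ⟨c, hc⟩ : ∃ c : ℕ, (c : ℤ) = G (i + 1) y - G i y :=
    ⟨(G (i + 1) y - G i y).toNat, by omega⟩
  have : (Finset.Icc 1 (T.len (i + 1))).filter (fun j => y < T.entry (i + 1) j) =
      Finset.Icc (T.len (i + 1) + 1 - c) (T.len (i + 1)) := by
    ext j
    rw [Finset.mem_filter, Finset.mem_Icc, Finset.mem_Icc]
    constructor
    · rintro ⟨⟨h2, h3⟩, h4⟩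
      have := (h i j y hi h2 h3).1 h4
      omega
    · rintro ⟨h2, h3⟩
      have := (h i j y hi (by omega) h3).2 (by omega)
      exact ⟨⟨by omega, h3⟩, this⟩
  rw [rowCount, this, Nat.card_Icc]
  omega

theorem Rep.countGt_eq {n : ℕ} {T : Filling} {G : ℕ → ℕ → ℤ} (h : Rep n T G)
    (hG : Hive n T.len G) {r : ℕ} (hr : r ≤ n) (y : ℕ) : countGt T r y = G r y := by
  induction r with
  | zero => simp [countGt, hG.zero]
  | succ r ih =>
    rw [countGt_succ, ih (by omega), h.rowCount_eq hG hr]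
    ring

theorem part_anti (lam : YoungDiagram) (i : ℕ) : part lam (i + 2) ≤ part lam (i + 1) :=
  lam.rowLen_anti i (i + 1) (by omega)

theorem part_eq_zero {lam : YoungDiagram} {i : ℕ} (h : length lam < i) : part lam i = 0 := by
  unfold part length at *
  by_contra hne
  have h1 : (i - 1, 0) ∈ lam := YoungDiagram.mem_iff_lt_rowLen.2 (Nat.pos_of_ne_zero hne)
  have := YoungDiagram.mem_iff_lt_colLen.1 h1
  omega

theorem part_le {mu lam : YoungDiagram} (h : mu ≤ lam) (i : ℕ) : part mu i ≤ part lam i := by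
  unfold part
  by_contra hlt
  have h1 : (i - 1, lam.rowLen (i - 1)) ∈ mu := YoungDiagram.mem_iff_lt_rowLen.2 (by omega)
  have := YoungDiagram.mem_iff_lt_rowLen.1 (h h1)
  omega

theorem le_of_part_le {mu lam : YoungDiagram} (h : ∀ i, part mu (i + 1) ≤ part lam (i + 1)) :
    mu ≤ lam := by
  rintro ⟨i, j⟩ hx
  have h1 := YoungDiagram.mem_iff_lt_rowLen.1 (show (i, j) ∈ mu from hx)
  exact YoungDiagram.mem_iff_lt_rowLen.2 (h1.trans_le (h i))

section LR

variable {n : ℕ} {lam mu nu : YoungDiagram} {T : Filling}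

theorem LR.entry_eq_zero (hT : T ∈ LR lam mu nu) (i j : ℕ)
    (h : ¬ (1 ≤ i ∧ 1 ≤ j ∧ j ≤ part lam i)) : T.entry i j = 0 := by
  have := hT.1.entry_pos_iff i j
  omega

theorem LR.row_sorted (hT : T ∈ LR lam mu nu) (i : ℕ) (hi : 1 ≤ i) (j : ℕ) (_ : 1 ≤ j)
    (hj : j + 1 ≤ T.len i) : T.entry i j ≤ T.entry i (j + 1) := by
  rw [hT.1.len_eq i hi] at hj
  have := hT.1.entry_pos_iff i j
  have := hT.2.1.row_weak i j hi
  omega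

theorem LR.rep (hT : T ∈ LR lam mu nu) (n : ℕ) : Rep n T (countGt T) := by
  intro i j y _ hj hj'
  rw [lt_entry_iff_of_sorted (LR.row_sorted hT (i + 1) (by omega)) j y hj hj', countGt_succ]
  omega

theorem LR.entry_lt_of_pos (hT : T ∈ LR lam mu nu) (i j : ℕ) (hi : 1 ≤ i)
    (hj : j ≤ part lam (i + 1)) (h : 0 < T.entry i j) : T.entry i j < T.entry (i + 1) j := by
  have h1 := (hT.1.entry_pos_iff i j).1 h
  have h2 := part_anti mu (i - 1)
  rw [show i - 1 + 2 = i + 1 by omega, show i - 1 + 1 = i by omega] at h2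
  exact hT.2.1.col_strict i j hi h1.2.1 h1.2.2 (by omega) hj

theorem LR.count_eq_zero (hT : T ∈ LR lam mu nu) (r s : ℕ) (h : r < s) : T.count s r = 0 := by
  induction r generalizing s with
  | zero => exact count_zero_rows T s
  | succ r ih =>
    have := hT.2.2.1 (r + 1) s (by omega) (by omega)
    rw [Nat.add_sub_cancel, ih (s - 1) (by omega)] at this
    omega

theorem LR.entry_le (hT : T ∈ LR lam mu nu) (i j : ℕ) : T.entry i j ≤ i := by
  by_contra hlt
  have h1 := (hT.1.entry_pos_iff i j).1 (by omega)
  have h2 := LR.count_eq_zero hT i (T.entry i j) (by omega)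
  obtain ⟨i, rfl⟩ : ∃ k, i = k + 1 := ⟨i - 1, by omega⟩
  rw [count_succ, Nat.add_eq_zero_iff, Finset.card_eq_zero] at h2
  have h3 : j ∈ (Finset.Icc 1 (T.len (i + 1))).filter
      (fun b => T.entry (i + 1) b = T.entry (i + 1) j) := by
    rw [Finset.mem_filter, Finset.mem_Icc, hT.1.len_eq _ (by omega)]
    exact ⟨⟨by omega, h1.2.2⟩, rfl⟩
  rw [h2.2] at h3
  simp at h3

theorem LR.rowCount_zero (hT : T ∈ LR lam mu nu) (i : ℕ) (hi : 1 ≤ i) :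
    rowCount T i 0 + part mu i = T.len i := by
  have h1 := part_le hT.1.inner_le i
  have h2 := hT.1.len_eq i hi
  have : (Finset.Icc 1 (T.len i)).filter (fun j => 0 < T.entry i j) =
      Finset.Icc (part mu i + 1) (T.len i) := by
    ext j
    have := hT.1.entry_pos_iff i j
    rw [Finset.mem_filter, Finset.mem_Icc, Finset.mem_Icc]
    omega
  rw [rowCount, this, Nat.card_Icc]
  omega

/-- A nonzero entry has a strictly larger one below it, so an entry `≤ z` lies below an entry `≤ y`.
The case `z = y + 1` yields `col`, and `y = z = 0` yields `col_zero`. -/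
theorem LR.rowCount_succ_row (hT : T ∈ LR lam mu nu) (i y z : ℕ) (hz : z ≤ y + 1) :
    T.len (i + 2) + rowCount T (i + 1) y ≤ T.len (i + 1) + rowCount T (i + 2) z := by
  have compl : ∀ a w, rowCount T a w +
      ((Finset.Icc 1 (T.len a)).filter (fun j => ¬ w < T.entry a j)).card = T.len a := by
    intro a w
    have := Finset.card_filter_add_card_filter_not (s := Finset.Icc 1 (T.len a))
      (fun j => w < T.entry a j)
    rw [Nat.card_Icc] at this
    simpa [rowCount] using this
  have h1 := compl (i + 1) y
  have h2 := compl (i + 2) z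
  have h3 : ((Finset.Icc 1 (T.len (i + 2))).filter (fun j => ¬ z < T.entry (i + 2) j)).card ≤
      ((Finset.Icc 1 (T.len (i + 1))).filter (fun j => ¬ y < T.entry (i + 1) j)).card := by
    refine Finset.card_le_card fun j hj => ?_
    have h4 := part_anti lam i
    rw [Finset.mem_filter, Finset.mem_Icc, hT.1.len_eq _ (by omega)] at hj ⊢
    refine ⟨⟨hj.1.1, by omega⟩, fun hy => ?_⟩
    have h5 : T.entry (i + 1) j < T.entry (i + 2) j :=
      LR.entry_lt_of_pos hT (i + 1) j (by omega) hj.1.2 (by omega)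
    omega
  omega

theorem LR.hive (hT : T ∈ LR lam mu nu) (n : ℕ) : Hive n T.len (countGt T) where
  zero y := by simp [countGt]
  top i y _ hy := by
    refine Finset.sum_eq_zero fun a ha => ?_
    rw [Finset.mem_range] at ha
    rw [rowCount, Nat.cast_eq_zero, Finset.card_eq_zero, Finset.filter_eq_empty_iff]
    intro j _
    have := LR.entry_le hT (a + 1) j
    omega
  row i y _ := by
    have := rowCount_succ T (i + 1) y
    rw [countGt_succ, countGt_succ]
    omega
  inner i _ := by
    have := rowCount_le T (i + 1) 0
    rw [countGt_succ]
    omega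
  col i y _ := by
    have := LR.rowCount_succ_row hT i y (y + 1) le_rfl
    have h1 : countGt T (i + 2) (y + 1) = countGt T (i + 1) (y + 1) + rowCount T (i + 2) (y + 1) :=
      countGt_succ T (i + 1) (y + 1)
    have h2 := countGt_succ T i y
    omega
  col_zero i _ := by
    have := LR.rowCount_succ_row hT i 0 0 (by omega)
    have h1 : countGt T (i + 2) 0 = countGt T (i + 1) 0 + rowCount T (i + 2) 0 :=
      countGt_succ T (i + 1) 0
    have h2 := countGt_succ T i 0
    omega
  lat i y _ := by
    have h1 : T.count (y + 2) (i + 1) ≤ T.count (y + 1) i :=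
      hT.2.2.1 (i + 1) (y + 2) (by omega) (by omega)
    have h2 : (T.count (y + 2) (i + 1) : ℤ) = countGt T (i + 1) (y + 1) - countGt T (i + 1) (y + 2) :=
      count_eq T (y + 1) (i + 1)
    have h3 := count_eq T y i
    omega

/-- A filling which represents a hive is a Littlewood--Richardson tableau. -/
theorem mem_LR_of_hive {S : Filling} {G : ℕ → ℕ → ℤ} (hlam : length lam ≤ n)
    (hG : Hive n S.len G) (hS : Rep n S G) (h0 : S.len 0 = 0)
    (hlen : ∀ a, 1 ≤ a → S.len a = part lam a)
    (hout : ∀ i j, ¬ (1 ≤ i ∧ 1 ≤ j ∧ j ≤ part lam i) → S.entry i j = 0)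
    (hinner : ∀ i, i < n → (part mu (i + 1) : ℤ) = S.len (i + 1) - (G (i + 1) 0 - G i 0))
    (hinner' : ∀ i, n < i → part mu i = 0)
    (hweight : ∀ y, (part nu (y + 1) : ℤ) = G n y - G n (y + 1)) : S ∈ LR lam mu nu := by
  have hlen0 : ∀ a, length lam < a → S.len a = 0 := fun a ha => by
    rw [hlen a (by omega), part_eq_zero ha]
  have hmu : ∀ i, part mu (i + 1) ≤ part lam (i + 1) := by
    intro i
    rcases lt_or_ge i n with hi | hi
    · have h1 := hinner i hi
      have h2 := hlen (i + 1) (by omega)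
      have h3 := hG.row_nonneg hi 0
      omega
    · rw [hinner' (i + 1) (by omega)]
      exact Nat.zero_le _
  have hin : ∀ i j, 1 ≤ i → 1 ≤ j → j ≤ part lam i → i ≤ n := by
    intro i j hi hj hj'
    by_contra hlt
    rw [part_eq_zero (by omega)] at hj'
    omega
  refine ⟨⟨le_of_part_le hmu, h0, hlen, ?_⟩, ⟨?_, ?_⟩, ?_, ?_⟩
  · intro i j
    by_cases hc : 1 ≤ i ∧ 1 ≤ j ∧ j ≤ part lam i
    · obtain ⟨i, rfl⟩ : ∃ k, i = k + 1 := ⟨i - 1, by omega⟩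
      have h1 := hin _ _ hc.1 hc.2.1 hc.2.2
      have h2 := hlen (i + 1) (by omega)
      rw [hS i j 0 (by omega) hc.2.1 (by omega)]
      have := hinner i (by omega)
      omega
    · rw [hout i j hc]
      omega
  · intro i j hi h1 h2
    obtain ⟨i, rfl⟩ : ∃ k, i = k + 1 := ⟨i - 1, by omega⟩
    have h3 := hin _ _ hi (by omega) h2
    have h4 := hlen (i + 1) (by omega)
    refine le_of_forall_lt fun y hy => ?_
    rw [hS i j y (by omega) (by omega) (by omega)] at hy
    rw [hS i (j + 1) y (by omega) (by omega) (by omega)]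
    push_cast
    omega
  · intro i j hi h1 h2 h3 h4
    obtain ⟨i, rfl⟩ : ∃ k, i = k + 1 := ⟨i - 1, by omega⟩
    have h5 := hin _ _ (by omega) (by omega) h4
    have h6 := hlen (i + 1) (by omega)
    have h7 := hlen (i + 2) (by omega)
    have h8 := hS i j 0 (by omega) (by omega) (by omega)
    have h9 := hinner i (by omega)
    obtain ⟨y, hy⟩ : ∃ y, S.entry (i + 1) j = y + 1 := ⟨S.entry (i + 1) j - 1, by omega⟩
    have h10 := hS i j y (by omega) (by omega) (by omega)
    have e : S.entry (i + 1 + 1) j = S.entry (i + 2) j := rfl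
    have h11 : y + 1 < S.entry (i + 2) j ↔ (S.len (i + 2) : ℤ) + G (i + 1) (y + 1) <
      j + G (i + 2) (y + 1) := hS (i + 1) j (y + 1) (by omega) (by omega) (by
        rw [show i + 1 + 1 = i + 2 from rfl] at *
        omega)
    have h12 := hG.col i y (by omega)
    omega
  · have hcount : ∀ r y, r ≤ n → (S.count (y + 1) r : ℤ) = G r y - G r (y + 1) := by
      intro r y hr
      rw [count_eq, hS.countGt_eq hG hr, hS.countGt_eq hG hr]
    have key : ∀ r y, r < n → S.count (y + 2) (r + 1) ≤ S.count (y + 1) r := by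
      intro r y hr
      have h1 := hcount (r + 1) (y + 1) hr
      have h2 := hcount r y hr.le
      have h3 := hG.lat r y hr
      rw [show y + 1 + 1 = y + 2 from rfl] at h1
      omega
    intro r s hr hs
    obtain ⟨r, rfl⟩ : ∃ k, r = k + 1 := ⟨r - 1, by omega⟩
    obtain ⟨y, rfl⟩ : ∃ k, s = k + 2 := ⟨s - 2, by omega⟩
    rw [show y + 2 - 1 = y + 1 from rfl, Nat.add_sub_cancel]
    rcases lt_or_ge r n with h1 | h1
    · exact key r y h1
    -- Rows beyond `n` are empty, so the inequality reduces to the one for row `n`.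
    · have hz : ∀ a, n < a → S.len a = 0 := fun a ha => hlen0 a (by omega)
      rw [count_eq_of_len_zero S _ (show n ≤ r + 1 by omega) hz,
        count_eq_of_len_zero S _ h1 hz]
      rcases Nat.eq_zero_or_pos n with rfl | hn
      · rw [count_zero_rows]
        exact Nat.zero_le _
      · obtain ⟨k, rfl⟩ : ∃ k, n = k + 1 := ⟨n - 1, by omega⟩
        exact (key k y (by omega)).trans (count_mono _ _ _)
  · intro s hs
    obtain ⟨y, rfl⟩ : ∃ k, s = k + 1 := ⟨s - 1, by omega⟩
    have h1 := count_eq S y n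
    have h2 := hweight y
    rw [hS.countGt_eq hG le_rfl, hS.countGt_eq hG le_rfl] at h1
    rw [← count_eq_of_len_zero S _ hlam hlen0]
    omega

/-! ### The partner map on Littlewood–Richardson tableaux -/

theorem LR.weight (hT : T ∈ LR lam mu nu) (hlam : length lam ≤ n) (y : ℕ) :
    (part nu (y + 1) : ℤ) = countGt T n y - countGt T n (y + 1) := by
  rw [← count_eq, ← hT.2.2.2 (y + 1) (by omega), count_eq_of_len_zero T _ hlam]
  intro a ha
  rw [hT.1.len_eq a (by omega), part_eq_zero ha]

/-- The filling `rho n T` has the row lengths of `T` and represents the partner hive. -/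
theorem LR.rho_spec (hT : T ∈ LR lam mu nu) (hlam : length lam ≤ n) :
    (rho n T).len = T.len ∧
      (∀ i j, ¬ (1 ≤ i ∧ 1 ≤ j ∧ j ≤ part lam i) → (rho n T).entry i j = 0) ∧
      ∃ F, Family n T.len F ∧ F n = countGt T ∧ Rep n (rho n T) (partner T.len F) := by
  obtain ⟨F, hF, hFn, h1, h2, h3, h4⟩ :=
    allSteps_spec Filling.empty (fun _ _ => rfl) (LR.hive hT n) (LR.rep hT n)
  refine ⟨?_, ?_, F, hF, hFn, h4⟩
  · funext a
    by_cases ha : a = 0 ∨ n < a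
    · refine (h3 a ha).1.trans ?_
      rcases ha with rfl | ha
      · exact hT.1.len_zero.symm
      · rw [hT.1.len_eq a (by omega), part_eq_zero (by omega)]
        rfl
    · obtain ⟨a, rfl⟩ : ∃ k, a = k + 1 := ⟨a - 1, by omega⟩
      exact h1 a (by omega)
  · intro i j hij
    by_cases ha : i = 0 ∨ n < i
    · exact (h3 i ha).2 j
    · obtain ⟨i, rfl⟩ : ∃ k, i = k + 1 := ⟨i - 1, by omega⟩
      refine h2 i j (by omega) ?_
      rw [hT.1.len_eq _ (by omega)]
      omega

theorem LR.rho_mem (hT : T ∈ LR lam mu nu) (hlam : length lam ≤ n) : rho n T ∈ LR lam nu mu := by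
  obtain ⟨hlen, hout, F, hF, hFn, hR⟩ := LR.rho_spec hT hlam
  have hG := LR.hive hT n
  have hw := LR.weight hT hlam
  refine mem_LR_of_hive (G := partner T.len F) hlam (by rw [hlen]; exact hF.partner_hive) hR
    (by rw [hlen]; exact hT.1.len_zero) (fun a ha => by rw [hlen]; exact hT.1.len_eq a ha) hout
    ?_ ?_ ?_
  · intro i hi
    rw [hw i, hlen, partner_of_le _ _ (by omega), partner_of_le _ _ (by omega), lenSum_succ,
      (hF.hive i hi.le).top 0 0 (by omega) le_rfl, (hF.hive (i + 1) hi).top 0 0 (by omega) le_rfl,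
      hF.last_eq i hi.le 0 (by omega), hF.last_eq (i + 1) hi 0 (by omega), hFn]
    ring
  · intro i hi
    obtain ⟨i, rfl⟩ : ∃ k, i = k + 1 := ⟨i - 1, by omega⟩
    have := hw i
    rw [hG.top n i le_rfl (by omega), hG.top n (i + 1) le_rfl (by omega)] at this
    omega
  · intro y
    rcases lt_or_ge y n with hy | hy
    · rw [partner_of_le _ _ hy.le, partner_of_le _ _ hy, lenSum_succ, hFn, countGt_succ]
      have := LR.rowCount_zero hT (y + 1) (by omega)
      omega
    · rw [partner_of_ge _ _ hy, partner_of_ge _ _ (by omega)]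
      have h1 := part_le hT.1.inner_le (y + 1)
      rw [part_eq_zero (show length lam < y + 1 by omega)] at h1
      omega

theorem LR.rho_rho (hT : T ∈ LR lam mu nu) (hlam : length lam ≤ n) : rho n (rho n T) = T := by
  have hS := LR.rho_mem hT hlam
  obtain ⟨hlen, -, F, hF, hFn, hR⟩ := LR.rho_spec hT hlam
  obtain ⟨hlen', hout, W, hW, hWn, hR'⟩ := LR.rho_spec hS hlam
  rw [hlen] at hlen' hW hR'
  -- Running only the steps `m, …, 1` ignores the later rows, which yields the deletion family of
  -- the first `m` rows of `T`.
  have hfam : ∀ m, ∃ F, Family m T.len F ∧ F m = countGt T := by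
    intro m
    obtain ⟨F, hF, hFn, -⟩ :=
      allSteps_spec Filling.empty (fun _ _ => rfl) (LR.hive hT m) (LR.rep hT m)
    exact ⟨F, hF, hFn⟩
  choose E hE hEm using hfam
  have hWE : ∀ i y, i ≤ n → W n i y = partner T.len (Function.update E n F n) i y := by
    intro i y hi
    rw [hWn, Function.update_self]
    exact hR.countGt_eq (by rw [hlen]; exact hF.partner_hive) hi y
  -- At index `n` the chosen family is replaced by the `F` for which `rho n T` is known to represent
  -- the partner hive.
  have key := Family.partner_partner (F := Function.update E n F) (G := countGt T)
    (fun m _ => by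
      by_cases hm : m = n
      · subst hm
        rwa [Function.update_self]
      · rw [Function.update_of_ne hm]
        exact hE m)
    (fun m i y _ _ => by
      by_cases hm : m = n
      · subst hm
        rw [Function.update_self, hFn]
      · rw [Function.update_of_ne hm, hEm]) hW hWE
  refine Filling.ext hlen' ?_
  funext i j
  by_cases hc : 1 ≤ i ∧ 1 ≤ j ∧ j ≤ part lam i
  · obtain ⟨i, rfl⟩ : ∃ k, i = k + 1 := ⟨i - 1, by omega⟩
    have hi : i < n := by
      by_contra hlt
      rw [part_eq_zero (by omega)] at hc
      omega
    have hj : j ≤ T.len (i + 1) := by rw [hT.1.len_eq _ (by omega)]; exact hc.2.2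
    refine eq_of_forall_lt_iff fun y => ?_
    rw [hR' i j y hi hc.2.1 (by rwa [hlen']), LR.rep hT n i j y hi hc.2.1 hj, hlen',
      key _ hi, key _ hi.le]
  · rw [hout i j hc, LR.entry_eq_zero hT i j hc]

end LR

end LRTab

theorem theorem5p1 (n : ℕ) (hn : 0 < n) :
    (∀ lam mu nu : YoungDiagram, LRTab.length lam ≤ n →
      Set.BijOn (LRTab.rho n) (LRTab.LR lam mu nu) (LRTab.LR lam nu mu)) ∧
    Set.BijOn (LRTab.rho n) (LRTab.LRn n) (LRTab.LRn n) ∧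
    ∀ T ∈ LRTab.LRn n, LRTab.rho n (LRTab.rho n T) = T := by
  have inv : ∀ T ∈ LRTab.LRn n, LRTab.rho n (LRTab.rho n T) = T := by
    rintro T ⟨lam, mu, nu, hlam, hT⟩
    exact LRTab.LR.rho_rho hT hlam
  have maps : Set.MapsTo (LRTab.rho n) (LRTab.LRn n) (LRTab.LRn n) := by
    rintro T ⟨lam, mu, nu, hlam, hT⟩
    exact ⟨lam, nu, mu, hlam, LRTab.LR.rho_mem hT hlam⟩
  refine ⟨fun lam mu nu hlam => ?_, Set.InvOn.bijOn ⟨inv, inv⟩ maps maps, inv⟩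
  exact Set.InvOn.bijOn (f' := LRTab.rho n)
    ⟨fun T hT => LRTab.LR.rho_rho hT hlam, fun T hT => LRTab.LR.rho_rho hT hlam⟩
    (fun T hT => LRTab.LR.rho_mem hT hlam) (fun T hT => LRTab.LR.rho_mem hT hlam)
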